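/- \textbf{Model.} An instance of distributed maximum coverage consists of an indexed family $S_1,\dots,S_m$ of subsets of $[n]$ (repetitions and empty sets allowed), an arbitrary partition of these $m$ sets among $p$ machines, and a parameter $k$; $\mathrm{opt}$ is the largest number of elements covered by at most $k$ of the sets. An $r$-round protocol in the blackboard (coordinator) model proceeds in $r$ rounds; in each round all machines simultaneously write a bit string on a blackboard visible to everyone, where the message of a machine depends on its own (indexed) sets, the current content of the blackboard, public randomness and its private randomness. After $r$ rounds the coordinator outputs a real number $v$ depending only on the blackboard and the public randomness. The protocol approximates the value of the optimal solution within a factor $\alpha\ge 1$ with probability at least $3/4$ if, on every instance, $\Pr[\,\mathrm{opt}/\alpha\le v\le \mathrm{opt}\,]\ge 3/4$ (for $\mathrm{opt}=0$: $v=0$). Its communication per machine is the maximum, over all machines, all instances and all outcomes of the randomness, of the total number of bits written by a machine over all rounds. \textbf{Theorem.} There are absolute constants $\varepsilon,\delta,a_1,a_2,b_1,b_2>0$ such that the following holds for all integers $r\ge 1$, $c\ge 4r$ and $k\ge 3$ with $$c\;\le\;\varepsilon\cdot\frac{\log k}{\log\log k}$$ ($\log$ is the natural logarithm). There exist integers $n,m$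 with $$m^{1/(a_2c)}\le n\le m^{1/(a_1c)}\qquad\text{and}\qquad b_1\,n^{2r/(2r+1)}\le k\le b_2\,n^{2r/(2r+1)}$$ (that is, $n=m^{1/\Theta(c)}$ and $k=\Theta(n^{2r/(2r+1)})$) such that every $r$-round protocol for maximum coverage with parameter $k$ on instances with $m$ sets, $n$ elements and $k$ machines that, with probability at least $3/4$, approximates the value of the optimal solution within some factor $$1\le\alpha<\frac{1}{2c}\cdot\frac{k^{1/(2r)}}{\log k}$$ requires communication at least $$\delta\cdot\frac{k}{r^4}\cdot m^{\frac{c}{(c+2)\cdot 4r}}$$ per machine. -/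

import Mathlib

open MeasureTheory

/-- An input of the distributed maximum coverage problem: an indexed collection of `m` subsets of
the universe `Fin n` (repetitions and empty sets are allowed), partitioned arbitrarily among `p`
machines; the set with index `j` is held by the machine `owner j`. -/
structure CoverageInstance (n m p : ℕ) where
  sets : Fin m → Finset (Fin n)
  owner : Fin m → Fin p

namespace CoverageInstance

variable {n m p : ℕ}

/-- The input of machine `i`: the indexed family of the sets it holds. -/
def view (I : CoverageInstance n m p) (i : Fin p) : Fin m → Option (Finset (Fin n)) :=
  fun j => if I.owner j = i then some (I.sets j) else none

/-- The optimum value: the largest number of elements covered by (at most) `k` of the sets. -/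
def opt (I : CoverageInstance n m p) (k : ℕ) : ℕ :=
  (Finset.univ.filter fun T : Finset (Fin m) => T.card ≤ k).sup fun T => (T.biUnion I.sets).card

end CoverageInstance

/-- The content of the blackboard: a list with one entry for each completed round, the entry being
the tuple of the bit strings that the `p` players wrote simultaneously in that round. -/
abbrev Blackboard (p : ℕ) : Type := List (Fin p → List Bool)

/-- A randomized `r`-round protocol in the number-in-hand model with a shared blackboard, for `p`
players with inputs in `X` and a referee who outputs a real number. There is a public random source
and, for every player, a private one; all of them are independent. In each round, the message of
player `i` depends on the input of `i`, the content of the blackboard, the public randomness and the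
private randomness of `i`. The output depends on the blackboard after `r` rounds and the public
randomness. (`r` is the number of rounds for which the protocol is run, see `output`.) -/
structure BlackboardProtocol (r p : ℕ) (X : Type) where
  Pub : Type
  Priv : Fin p → Type
  [measPub : MeasurableSpace Pub]
  [measPriv : ∀ i, MeasurableSpace (Priv i)]
  pubLaw : Measure Pub
  privLaw : ∀ i, Measure (Priv i)
  [probPub : IsProbabilityMeasure pubLaw]
  [probPriv : ∀ i, IsProbabilityMeasure (privLaw i)]
  message : ∀ i : Fin p, X → Blackboard p → Pub → Priv i → List Bool
  referee : Blackboard p → Pub → ℝ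
  measurable_message : ∀ (i : Fin p) (x : X) (b : Blackboard p) (s : List Bool),
    MeasurableSet {ω : Pub × Priv i | message i x b ω.1 ω.2 = s}
  measurable_referee : ∀ b : Blackboard p, Measurable (referee b)

namespace BlackboardProtocol

attribute [instance] measPub measPriv probPub probPriv

variable {r p : ℕ} {X : Type}

/-- The joint outcomes of the public and all the private random sources. -/
abbrev Coins (π : BlackboardProtocol r p X) : Type := π.Pub × (∀ i, π.Priv i)

/-- The law of the randomness: all sources are independent. -/
noncomputable def law (π : BlackboardProtocol r p X) : Measure π.Coins :=
  π.pubLaw.prod (Measure.pi π.privLaw)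

/-- The content of the blackboard after `t` rounds on the inputs `x`. -/
def board (π : BlackboardProtocol r p X) (x : Fin p → X) (ω : π.Coins) : ℕ → Blackboard p
  | 0 => []
  | t + 1 => π.board x ω t ++ [fun i => π.message i (x i) (π.board x ω t) ω.1 (ω.2 i)]

/-- The output of the referee, after `r` rounds. -/
def output (π : BlackboardProtocol r p X) (x : Fin p → X) (ω : π.Coins) : ℝ :=
  π.referee (π.board x ω r) ω.1

/-- The number of bits that player `i` writes on the blackboard during the `r` rounds. -/
def bitsSent (π : BlackboardProtocol r p X) (x : Fin p → X) (ω : π.Coins) (i : Fin p) : ℕ :=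
  ((π.board x ω r).map fun w => (w i).length).sum

end BlackboardProtocol

/-- An `r`-round protocol for maximum coverage with `m` sets, `n` elements and `p` machines. -/
abbrev CoverageProtocol (r n m p : ℕ) : Type 1 :=
  BlackboardProtocol r p (Fin m → Option (Finset (Fin n)))

namespace CoverageProtocol

variable {r n m p : ℕ}

/-- On every instance, with probability at least `3/4`, the output `v` of the protocol is an
approximation of the optimum value within the factor `α`: `opt / α ≤ v ≤ opt`. -/
def Approximates (π : CoverageProtocol r n m p) (k : ℕ) (α : ℝ) : Prop :=
  ∀ I : CoverageInstance n m p,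
    3 / 4 ≤ π.law {ω | π.output I.view ω ≤ (I.opt k : ℝ) ∧ (I.opt k : ℝ) ≤ α * π.output I.view ω}

/-- The per-machine communication cost is at most `B`: on every instance and for every outcome of
the randomness, each machine writes at most `B` bits in total. -/
def CommunicationAtMost (π : CoverageProtocol r n m p) (B : ℕ) : Prop :=
  ∀ (I : CoverageInstance n m p) (ω : π.Coins) (i : Fin p), π.bitsSent I.view ω i ≤ B

end CoverageProtocol

/-! Two input distributions, "yes" and "no", are built whose optima are far apart but which short
`r`-round protocols cannot distinguish. All coins are fixed by averaging, so only deterministic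
protocols have to be fooled.

The pair is built recursively, with colours C = F_q. At level 0 one player holds one set, which is
all of C or empty. At the next level there are g groups of players; each group receives an
independent copy of the previous pair, all with the same answer, hidden at a common random index j*
among q^(16c) families. The other families are fillers drawn from marginals that do not depend on
the answer. A group sees q labelled copies of the old universe E, and family j is written along the
graph of a polynomial f_j in the colour. The graph of f_j* is sent to a private region of the group,
the rest to a region of size |E|(q-1) common to all groups, and a random colour-preserving
permutation is applied.

Choosing the hidden sets, the groups cover disjoint regions, so "yes" instances have optimum at
least q g^r (`coversAtLeast_hard`). A filler set has at most one element of each colour, so it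
enters the private regions only at colours where two polynomials agree, at most 16c of them. Hence
"no" instances have optimum at most r q(q-1)(q-1+g)^(r-1) + 16ck (`coverBound_hard`). With κ =
k^(1/(2r)), q about κ and g about κ², these values are of order κk and at most 17ck.

Indistinguishability is round elimination (`AdvantageAtMost.hide`). The labels of a single group are
independent of j* (`sum_relabel_eq`), and a short message depends little on an average coordinate of
a product (`sum_influence_le`). So first messages can be replaced by messages independent of the
hidden inputs, with fillers resampled to fit them. What remains is a protocol with one round less on
g independent copies, and a hybrid argument costs a factor g. The total advantage stays below 1/2
when B k^10 ≤ q^(16c), whereas a correct protocol has advantage at least 1/2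
(`half_le_of_approximates`). -/

/-- `p` is a probability weight on a finite type. -/
structure IsProbWeight {α : Type*} [Fintype α] (p : α → ℝ) : Prop where
  nonneg : ∀ a, 0 ≤ p a
  sum_eq_one : ∑ a, p a = 1

/-- The product weight on a finite product. -/
def prodWeight {ι α : Type*} [Fintype ι] (a : ι → α → ℝ) (x : ι → α) : ℝ := ∏ i, a i (x i)

/-- The push-forward of a weight along a map. -/
def pushWeight {α β : Type*} [Fintype α] [DecidableEq β] (f : α → β) (p : α → ℝ) (b : β) : ℝ :=
  ∑ a, if f a = b then p a else 0

theorem prodWeight_eq_mul_prod_erase {ι α : Type*} [Fintype ι] [DecidableEq ι]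
    (a : ι → α → ℝ) (x : ι → α) (i : ι) :
    prodWeight a x = a i (x i) * ∏ j ∈ Finset.univ.erase i, a j (x j) :=
  (Finset.mul_prod_erase _ _ (Finset.mem_univ i)).symm

theorem prod_erase_update {ι α M : Type*} [Fintype ι] [DecidableEq ι] [CommMonoid M]
    (f : ι → α → M) (x : ι → α) (i : ι) (y : α) :
    ∏ j ∈ Finset.univ.erase i, f j (Function.update x i y j) =
      ∏ j ∈ Finset.univ.erase i, f j (x j) :=
  Finset.prod_congr rfl fun j hj => by
    rw [Function.update_of_ne (Finset.ne_of_mem_erase hj)]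

/-! ### Finite probability weights: products, push-forwards and resampling. -/

section Weights

variable {ι α β : Type*} [Fintype ι] [DecidableEq ι] [Fintype α]

theorem IsProbWeight.prodWeight {a : ι → α → ℝ} (ha : ∀ i, IsProbWeight (a i)) :
    IsProbWeight (prodWeight a) where
  nonneg x := Finset.prod_nonneg fun i _ => (ha i).nonneg _
  sum_eq_one := by
    have := Finset.prod_univ_sum (fun _ : ι => (Finset.univ : Finset α)) a
    rw [Fintype.piFinset_univ] at this
    simp only [_root_.prodWeight]
    rw [← this]
    exact Finset.prod_eq_one fun i _ => (ha i).sum_eq_one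

theorem sum_pushWeight_mul [Fintype β] [DecidableEq β] (f : α → β) (p : α → ℝ) (F : β → ℝ) :
    ∑ b, pushWeight f p b * F b = ∑ a, p a * F (f a) := by
  simp only [pushWeight, Finset.sum_mul]
  rw [Finset.sum_comm]
  refine Finset.sum_congr rfl fun a _ => ?_
  simp [ite_mul]

theorem IsProbWeight.push [Fintype β] [DecidableEq β] {p : α → ℝ} (hp : IsProbWeight p) (f : α → β) :
    IsProbWeight (pushWeight f p) where
  nonneg b := Finset.sum_nonneg fun a _ => by split_ifs <;> simp [hp.nonneg]
  sum_eq_one := by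
    have := sum_pushWeight_mul f p (fun _ => 1)
    simpa [hp.sum_eq_one] using this

theorem exists_of_pushWeight_ne_zero [DecidableEq β] {f : α → β} {p : α → ℝ} {b : β}
    (h : pushWeight f p b ≠ 0) : ∃ a, p a ≠ 0 ∧ f a = b := by
  obtain ⟨a, -, ha⟩ := Finset.exists_ne_zero_of_sum_ne_zero h
  by_cases hf : f a = b
  · exact ⟨a, by simpa [hf] using ha, hf⟩
  · simp [hf] at ha

theorem IsProbWeight.abs_sum_le {p : α → ℝ} (hp : IsProbWeight p) {F : α → ℝ} {ε : ℝ}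
    (hF : ∀ a, |F a| ≤ ε) : |∑ a, p a * F a| ≤ ε := by
  calc |∑ a, p a * F a| ≤ ∑ a, |p a * F a| := Finset.abs_sum_le_sum_abs _ _
    _ ≤ ∑ a, p a * ε := by
        refine Finset.sum_le_sum fun a _ => ?_
        rw [abs_mul, abs_of_nonneg (hp.nonneg a)]
        exact mul_le_mul_of_nonneg_left (hF a) (hp.nonneg a)
    _ = ε := by rw [← Finset.sum_mul, hp.sum_eq_one, one_mul]

/-- Resampling one coordinate of a product weight. -/
theorem sum_prodWeight_update_mul {a : ι → α → ℝ} (i : ι) (ha : ∑ y, a i y = 1) (p : α → ℝ)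
    (F : (ι → α) → ℝ) :
    ∑ x, prodWeight (Function.update a i p) x * F x =
      ∑ x, prodWeight a x * ∑ y, p y * F (Function.update x i y) := by
  have h1 : ∑ x, prodWeight a x * ∑ y, p y * F (Function.update x i y) =
      ∑ v : (ι → α) × α, prodWeight a v.1 * (p v.2 * F (Function.update v.1 i v.2)) := by
    rw [Fintype.sum_prod_type]
    simp [Finset.mul_sum]
  -- Exchanging coordinate `i` with the fresh sample carries one weighted sum over pairs to the
  -- other.
  have inv : Function.Involutive
      (fun v : (ι → α) × α => ((Function.update v.1 i v.2, v.1 i) : (ι → α) × α)) := by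
    rintro ⟨x, y⟩
    simp
  rw [h1, ← Equiv.sum_comp inv.toPerm, Fintype.sum_prod_type]
  refine Finset.sum_congr rfl fun x _ => ?_
  have h2 : prodWeight (Function.update a i p) x =
      p (x i) * ∏ j ∈ Finset.univ.erase i, a j (x j) := by
    rw [prodWeight_eq_mul_prod_erase _ _ i, Function.update_self]
    congr 1
    exact Finset.prod_congr rfl fun j hj => by
      rw [Function.update_of_ne (Finset.ne_of_mem_erase hj)]
  rw [h2, ← one_mul (_ * F x), ← ha, Finset.sum_mul]
  refine Finset.sum_congr rfl fun y _ => ?_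
  simp only [Function.Involutive.coe_toPerm, Function.update_idem, Function.update_eq_self]
  rw [prodWeight_eq_mul_prod_erase _ _ i, prod_erase_update, Function.update_self]
  ring

theorem sum_prodWeight_resample {a : ι → α → ℝ} (i : ι) (ha : ∑ y, a i y = 1)
    (F : (ι → α) → ℝ) :
    ∑ x, prodWeight a x * F x =
      ∑ x, prodWeight a x * ∑ y, a i y * F (Function.update x i y) := by
  simpa using sum_prodWeight_update_mul i ha (a i) F

theorem sum_prodWeight_mul_eval {a : ι → α → ℝ} (ha : ∀ i, IsProbWeight (a i)) (i : ι)
    (f : α → ℝ) : ∑ x, prodWeight a x * f (x i) = ∑ y, a i y * f y := by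
  rw [sum_prodWeight_resample i (ha i).sum_eq_one (fun x => f (x i))]
  simp only [Function.update_self]
  rw [← Finset.sum_mul, (IsProbWeight.prodWeight ha).sum_eq_one, one_mul]

/-- Replacing the factors of a product weight one at a time. -/
theorem abs_sum_prodWeight_sub_le {a b : ι → α → ℝ} (ha : ∀ i, IsProbWeight (a i))
    (hb : ∀ i, IsProbWeight (b i)) (F : (ι → α) → ℝ) (δ : ι → ℝ)
    (h : ∀ i x, |∑ y, a i y * F (Function.update x i y) - ∑ y, b i y * F (Function.update x i y)|
      ≤ δ i) :
    |∑ x, prodWeight a x * F x - ∑ x, prodWeight b x * F x| ≤ ∑ i, δ i := by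
  have key : ∀ s : Finset ι, |∑ x, prodWeight (s.piecewise a b) x * F x -
      ∑ x, prodWeight b x * F x| ≤ ∑ i ∈ s, δ i := by
    intro s
    induction s using Finset.induction_on with
    | empty => simp
    | insert i s hi ih =>
      have hc : ∀ j, IsProbWeight (s.piecewise a b j) := fun j => by
        by_cases hj : j ∈ s <;> simp [hj, ha, hb]
      have e1 := sum_prodWeight_update_mul i (hc i).sum_eq_one (a i) F
      have e2 := sum_prodWeight_resample i (hc i).sum_eq_one F
      rw [Finset.piecewise_eq_of_notMem _ _ _ hi] at e2
      rw [Finset.piecewise_insert, Finset.sum_insert hi]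
      refine (abs_sub_le _ (∑ x, prodWeight (s.piecewise a b) x * F x) _).trans (add_le_add ?_ ih)
      rw [e1, e2, ← Finset.sum_sub_distrib]
      simp only [← mul_sub]
      exact (IsProbWeight.prodWeight hc).abs_sum_le fun x => h i x
  simpa using key Finset.univ

theorem sum_prodWeight_push [Fintype β] [DecidableEq β] (p : ι → α → ℝ) (f : ι → α → β)
    (F : (ι → β) → ℝ) :
    ∑ y, prodWeight (fun i => pushWeight (f i) (p i)) y * F y =
      ∑ x, prodWeight p x * F (fun i => f i (x i)) := by
  have h : ∀ y : ι → β, prodWeight (fun i => pushWeight (f i) (p i)) y =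
      pushWeight (fun x : ι → α => fun i => f i (x i)) (prodWeight p) y := by
    intro y
    simp only [prodWeight, pushWeight]
    rw [Finset.prod_univ_sum, Fintype.piFinset_univ]
    refine Finset.sum_congr rfl fun x _ => ?_
    by_cases hx : (fun i => f i (x i)) = y
    · subst hx; simp
    · rw [if_neg hx]
      obtain ⟨i, hi⟩ := Function.ne_iff.1 hx
      exact Finset.prod_eq_zero (Finset.mem_univ i) (if_neg hi)
  simp only [h]
  exact sum_pushWeight_mul _ _ _

/-- A family of kernels, one for each coordinate, is realised by random functions. -/
theorem sum_prodWeight_kernel {γ : Type*} [Fintype γ] [DecidableEq γ] [DecidableEq α]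
    {κ : ι → γ → α → ℝ}
    (hκ : ∀ i c, IsProbWeight (κ i c)) (x : ι → γ) (F : (ι → α) → ℝ) :
    ∑ z, prodWeight (fun i => κ i (x i)) z * F z =
      ∑ ζ : ι → γ → α, prodWeight (fun i => prodWeight (κ i)) ζ * F (fun i => ζ i (x i)) := by
  rw [← sum_prodWeight_push (fun i => prodWeight (κ i)) (fun i (ζ : γ → α) => ζ (x i)) F]
  have : ∀ i, pushWeight (fun ζ : γ → α => ζ (x i)) (prodWeight (κ i)) = κ i (x i) := by
    intro i
    funext b
    have := sum_prodWeight_mul_eval (hκ i) (x i) (fun y => if y = b then 1 else 0)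
    simpa [pushWeight] using this
  simp only [this]

end Weights

/-! ### Influence of a coordinate on a short message. -/

section Influence

variable {J X Ξ : Type*} [Fintype J] [DecidableEq J] [Fintype X] [Fintype Ξ] [DecidableEq Ξ]

/-- The law of `f` when one coordinate is fixed. -/
noncomputable def conditionalLaw (μ : X → ℝ) (f : (J → X) → Ξ) (j : J) (x : X) (m : Ξ) : ℝ :=
  pushWeight (fun z => f (Function.update z j x)) (prodWeight fun _ => μ) m

/-- Follows from e^y ≤ 1 + y + y² for |y| ≤ 1, where the linear term has mean zero. -/
theorem sum_exp_le_of_centered {μ : X → ℝ} (hμ : IsProbWeight μ) {g : X → ℝ}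
    (hg : ∀ x, |g x| ≤ 2) (h0 : ∑ x, μ x * g x = 0) {l : ℝ} (hl0 : 0 ≤ l) (hl : l ≤ 1 / 2) :
    ∑ x, μ x * Real.exp (l * g x) ≤ Real.exp (4 * l ^ 2) := by
  calc ∑ x, μ x * Real.exp (l * g x) ≤ ∑ x, μ x * (1 + l * g x + 4 * l ^ 2) := by
        refine Finset.sum_le_sum fun x _ => mul_le_mul_of_nonneg_left ?_ (hμ.nonneg x)
        have h2 : |l * g x| ≤ 1 := by
          rw [abs_mul, abs_of_nonneg hl0]; nlinarith [hg x, abs_nonneg (g x)]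
        have h3 := (abs_le.1 (Real.abs_exp_sub_one_sub_id_le h2)).2
        have h4 : (g x) ^ 2 ≤ 4 := by nlinarith [abs_le.1 (hg x)]
        nlinarith [sq_nonneg l]
    _ = 1 + 4 * l ^ 2 := by
        have : ∀ x, μ x * (1 + l * g x + 4 * l ^ 2) = (1 + 4 * l ^ 2) * μ x + l * (μ x * g x) :=
          fun x => by ring
        simp only [this, Finset.sum_add_distrib, ← Finset.mul_sum, h0, hμ.sum_eq_one]
        ring
    _ ≤ Real.exp (4 * l ^ 2) := by linarith [Real.add_one_le_exp (4 * l ^ 2)]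

/-- On average, a coordinate of a product has small influence on the law of a function with few
values. -/
theorem sum_influence_le {μ : X → ℝ} (hμ : IsProbWeight μ) (f : (J → X) → Ξ) {l : ℝ}
    (hl0 : 0 < l) (hl : l ≤ 1 / 2) {A : ℝ} (hA : Real.log (Fintype.card Ξ) ≤ A) :
    ∑ j, ∑ x, μ x * ∑ m, |conditionalLaw μ f j x m - pushWeight f (prodWeight fun _ => μ) m| ≤
      A / l + 4 * l * Fintype.card J := by
  set ν : (J → X) → ℝ := prodWeight fun _ => μ with hνdef
  have hν : IsProbWeight ν := IsProbWeight.prodWeight fun _ => hμ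
  -- Signs linearise the absolute values: the sum of the distances becomes the mean of `Z (f z) z`,
  -- where for each fixed `m` the statistic `Z m` is a sum of independent centred terms.
  set g : J → Ξ → X → ℝ := fun j m x => SignType.sign (conditionalLaw μ f j x m - pushWeight f ν m)
    with hgdef
  have hg1 : ∀ j m x, |g j m x| ≤ 1 := by
    intro j m x
    simp only [hgdef]
    rcases SignType.trichotomy (SignType.sign (conditionalLaw μ f j x m - pushWeight f ν m))
      with h | h | h <;> simp [h]
  set gm : J → Ξ → ℝ := fun j m => ∑ x, μ x * g j m x with hgmdef
  have hgm1 : ∀ j m, |gm j m| ≤ 1 := fun j m => hμ.abs_sum_le (hg1 j m)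
  set Z : Ξ → (J → X) → ℝ := fun m z => ∑ j, (g j m (z j) - gm j m) with hZdef
  have e1 : ∀ j m, ∑ x, μ x * |conditionalLaw μ f j x m - pushWeight f ν m| =
      ∑ z, ν z * (if f z = m then g j m (z j) - gm j m else 0) := by
    intro j m
    have a1 : ∀ x, μ x * |conditionalLaw μ f j x m - pushWeight f ν m| =
        μ x * (g j m x * conditionalLaw μ f j x m) - (μ x * g j m x) * pushWeight f ν m := by
      intro x
      have : |conditionalLaw μ f j x m - pushWeight f ν m| =
          g j m x * (conditionalLaw μ f j x m - pushWeight f ν m) := by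
        simp only [hgdef]; rw [sign_mul_self]
      rw [this]; ring
    have a2 : ∑ x, μ x * (g j m x * conditionalLaw μ f j x m) =
        ∑ z, ν z * (if f z = m then g j m (z j) else 0) := by
      rw [hνdef, sum_prodWeight_resample j hμ.sum_eq_one
        (fun z => if f z = m then g j m (z j) else 0)]
      simp only [conditionalLaw, pushWeight, Finset.mul_sum]
      rw [Finset.sum_comm]
      refine Finset.sum_congr rfl fun z _ => Finset.sum_congr rfl fun x _ => ?_
      simp only [Function.update_self]
      split_ifs <;> ring
    have a3 : gm j m * pushWeight f ν m = ∑ z, ν z * (if f z = m then gm j m else 0) := by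
      simp only [pushWeight, Finset.mul_sum]
      refine Finset.sum_congr rfl fun z _ => ?_
      split_ifs <;> ring
    simp only [a1]
    rw [Finset.sum_sub_distrib, ← Finset.sum_mul, a2, show ∑ x, μ x * g j m x = gm j m from rfl, a3,
      ← Finset.sum_sub_distrib]
    refine Finset.sum_congr rfl fun z _ => ?_
    split_ifs <;> ring
  have e2 : ∑ j, ∑ x, μ x * ∑ m, |conditionalLaw μ f j x m - pushWeight f ν m| =
      ∑ z, ν z * Z (f z) z := by
    have b1 : ∀ j, ∑ x, μ x * ∑ m, |conditionalLaw μ f j x m - pushWeight f ν m| =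
        ∑ z, ν z * (g j (f z) (z j) - gm j (f z)) := by
      intro j
      simp only [Finset.mul_sum]
      rw [Finset.sum_comm]
      simp only [e1]
      rw [Finset.sum_comm]
      refine Finset.sum_congr rfl fun z _ => ?_
      rw [← Finset.mul_sum]
      simp
    simp only [b1]
    rw [Finset.sum_comm]
    simp only [hZdef, Finset.mul_sum]
  have e3 : ∀ m, ∑ z, ν z * Real.exp (l * Z m z) ≤ Real.exp (4 * l ^ 2 * Fintype.card J) := by
    intro m
    have c1 : ∑ z, ν z * Real.exp (l * Z m z) =
        ∏ j, ∑ x, μ x * Real.exp (l * (g j m x - gm j m)) := by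
      rw [Finset.prod_univ_sum, Fintype.piFinset_univ]
      refine Finset.sum_congr rfl fun z _ => ?_
      rw [Finset.prod_mul_distrib, ← Real.exp_sum, ← Finset.mul_sum]
      rfl
    rw [c1]
    calc _ ≤ ∏ _j : J, Real.exp (4 * l ^ 2) := by
          refine Finset.prod_le_prod (fun j _ => Finset.sum_nonneg fun x _ =>
            mul_nonneg (hμ.nonneg x) (Real.exp_pos _).le) fun j _ => ?_
          refine sum_exp_le_of_centered hμ (fun x => ?_) ?_ hl0.le hl
          · exact (abs_sub _ _).trans (by linarith [hg1 j m x, hgm1 j m])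
          · simp only [mul_sub]
            rw [Finset.sum_sub_distrib, ← Finset.sum_mul, hμ.sum_eq_one, one_mul, sub_self]
      _ = _ := by
          rw [Finset.prod_const, Finset.card_univ, ← Real.exp_nat_mul]
          ring_nf
  have hX : Nonempty (J → X) := by
    by_contra h
    rw [not_nonempty_iff] at h
    have := hν.sum_eq_one
    simp at this
  have hΞ : 0 < (Fintype.card Ξ : ℝ) := by
    have : Nonempty Ξ := hX.map f
    exact_mod_cast Fintype.card_pos
  -- Chosen so that e^a is the number of messages times the exponential moment bound `e3`, that is,
  -- the bound for the sum over all messages.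
  set a : ℝ := Real.log (Fintype.card Ξ) + 4 * l ^ 2 * Fintype.card J with hadef
  have e4 : l * ∑ z, ν z * Z (f z) z ≤ a := by
    have d1 : ∀ z, l * Z (f z) z ≤ a - 1 + Real.exp (-a) * ∑ m, Real.exp (l * Z m z) := by
      intro z
      have h1 := Real.add_one_le_exp (l * Z (f z) z - a)
      have h2 : Real.exp (l * Z (f z) z) ≤ ∑ m, Real.exp (l * Z m z) :=
        Finset.single_le_sum (f := fun m => Real.exp (l * Z m z))
          (fun m _ => (Real.exp_pos _).le) (Finset.mem_univ (f z))
      have h3 : Real.exp (l * Z (f z) z - a) = Real.exp (-a) * Real.exp (l * Z (f z) z) := by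
        rw [← Real.exp_add]; ring_nf
      have h4 := mul_le_mul_of_nonneg_left h2 (Real.exp_pos (-a)).le
      linarith
    calc l * ∑ z, ν z * Z (f z) z = ∑ z, ν z * (l * Z (f z) z) := by
          rw [Finset.mul_sum]; exact Finset.sum_congr rfl fun z _ => by ring
      _ ≤ ∑ z, ν z * (a - 1 + Real.exp (-a) * ∑ m, Real.exp (l * Z m z)) :=
          Finset.sum_le_sum fun z _ => mul_le_mul_of_nonneg_left (d1 z) (hν.nonneg z)
      _ = (a - 1) + Real.exp (-a) * ∑ m, ∑ z, ν z * Real.exp (l * Z m z) := by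
          simp only [mul_add, Finset.sum_add_distrib]
          rw [← Finset.sum_mul, hν.sum_eq_one, one_mul]
          congr 1
          rw [Finset.sum_comm, Finset.mul_sum]
          refine Finset.sum_congr rfl fun z _ => ?_
          rw [← Finset.mul_sum]; ring
      _ ≤ (a - 1) + Real.exp (-a) * ∑ _m : Ξ, Real.exp (4 * l ^ 2 * Fintype.card J) := by
          gcongr with m; exact e3 m
      _ = a := by
          rw [Finset.sum_const, Finset.card_univ, nsmul_eq_mul, hadef]
          have h6 : (Fintype.card Ξ : ℝ) * Real.exp (4 * l ^ 2 * Fintype.card J) =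
              Real.exp (Real.log (Fintype.card Ξ) + 4 * l ^ 2 * Fintype.card J) := by
            rw [Real.exp_add, Real.exp_log hΞ]
          rw [h6, ← Real.exp_add, neg_add_cancel, Real.exp_zero]
          ring
  rw [e2]
  have : ∑ z, ν z * Z (f z) z ≤ a / l := by rw [le_div_iff₀ hl0]; linarith
  refine this.trans ?_
  rw [hadef, add_div]
  have h5 : 4 * l ^ 2 * (Fintype.card J : ℝ) / l = 4 * l * Fintype.card J := by
    field_simp
  rw [h5]
  gcongr

end Influence

/-! ### Deterministic protocols as functions of the inputs. -/

/-- Functions of the inputs with values in `[-1, 1]` that are determined by the transcript of a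
deterministic `l`-round protocol with messages in `Ξ`. -/
def RoundComputable (Ξ : Type) {P X : Type} : ℕ → ((P → X) → ℝ) → Prop
  | 0, F => ∃ c : ℝ, |c| ≤ 1 ∧ ∀ x, F x = c
  | l + 1, F => ∃ (msg : P → X → Ξ) (F' : (P → Ξ) → (P → X) → ℝ),
      (∀ m, RoundComputable Ξ l (F' m)) ∧ ∀ x, F x = F' (fun p => msg p (x p)) x

namespace RoundComputable

variable {Ξ P X Y G : Type} {l : ℕ}

theorem abs_le_one {F : (P → X) → ℝ} (hF : RoundComputable Ξ l F) (x : P → X) : |F x| ≤ 1 := by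
  induction l generalizing F with
  | zero => obtain ⟨c, hc, h⟩ := hF; rw [h]; exact hc
  | succ l ih => obtain ⟨msg, F', h, e⟩ := hF; rw [e]; exact ih (h _)

theorem comp {F : (P → X) → ℝ} (hF : RoundComputable Ξ l F) (h : P → Y → X) :
    RoundComputable Ξ l fun y : P → Y => F fun p => h p (y p) := by
  induction l generalizing F with
  | zero => obtain ⟨c, hc, e⟩ := hF; exact ⟨c, hc, fun _ => e _⟩
  | succ l ih =>
    obtain ⟨msg, F', h', e⟩ := hF
    exact ⟨fun p y => msg p (h p y), fun m y => F' m fun p => h p (y p), fun m => ih (h' m),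
      fun _ => e _⟩

/-- A protocol for the players `Q` is a protocol for the players `P` if the inputs of the other
players are fixed. -/
theorem comp_embedding {Q : Type} {F : (Q → Y) → ℝ} (hF : RoundComputable Ξ l F) {e : P → Q}
    (he : Function.Injective e) {V : (P → X) → Q → Y} {h : P → X → Y} {y : Q → Y}
    (h1 : ∀ x p, V x (e p) = h p (x p)) (h2 : ∀ x q, (¬∃ p, e p = q) → V x q = y q) :
    RoundComputable Ξ l fun x => F (V x) := by
  induction l generalizing F with
  | zero => obtain ⟨c, hc, e⟩ := hF; exact ⟨c, hc, fun _ => e _⟩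
  | succ l ih =>
    obtain ⟨msg, F', h', e'⟩ := hF
    -- Players outside the range of `e` have fixed inputs, so their messages are known constants
    -- that complete the tuple `m`.
    refine ⟨fun p x => msg (e p) (h p x),
      fun m x => F' (Function.extend e m fun q => msg q (y q)) (V x), fun m => ih (h' _),
      fun x => (e' _).trans ?_⟩
    dsimp only
    congr 1
    funext q
    by_cases hq : ∃ p, e p = q
    · obtain ⟨p, rfl⟩ := hq
      rw [he.extend_apply, h1]
    · rw [Function.extend_apply' _ _ _ hq, h2 _ _ hq]

/-- A protocol for several groups of players is a protocol for one of the groups if the inputs of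
the other groups are fixed. -/
theorem restrict [DecidableEq G] {F : (G × P → X) → ℝ} (hF : RoundComputable Ξ l F) (i : G)
    (I : G → P → X) :
    RoundComputable Ξ l fun x : P → X => F fun q => Function.update I i x q.1 q.2 := by
  refine hF.comp_embedding (e := fun p => (i, p)) (Prod.mk_right_injective i) (h := fun _ x => x)
    (y := fun q => I q.1 q.2) (fun x p => by simp) fun x q hq => ?_
  rw [Function.update_of_ne]
  rintro rfl
  exact hq ⟨q.2, rfl⟩

end RoundComputable

/-! ### Round elimination. -/

section Elimination

variable {G P J X Ξ : Type} [Fintype G] [DecidableEq G] [Fintype P] [DecidableEq P]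
  [Fintype J] [DecidableEq J] [Fintype X]

/-- The two distributions of the inputs have advantage at most `ε` in `l` rounds. -/
def AdvantageAtMost (Ξ : Type) (D : Bool → (P → X) → ℝ) (l : ℕ) (ε : ℝ) : Prop :=
  ∀ F : (P → X) → ℝ, RoundComputable Ξ l F →
    |∑ x, D true x * F x - ∑ x, D false x * F x| ≤ ε

theorem advantageAtMost_zero {D : Bool → (P → X) → ℝ} (hD : ∀ θ, IsProbWeight (D θ)) :
    AdvantageAtMost Ξ D 0 0 := by
  rintro F ⟨c, -, h⟩
  simp [h, ← Finset.sum_mul, (hD _).sum_eq_one]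

theorem AdvantageAtMost.mono {D : Bool → (P → X) → ℝ} {l : ℕ} {ε ε' : ℝ}
    (h : AdvantageAtMost Ξ D l ε) (hε : ε ≤ ε') : AdvantageAtMost Ξ D l ε' :=
  fun F hF => (h F hF).trans hε

/-- Independent groups of players multiply the advantage by at most the number of groups. -/
theorem AdvantageAtMost.groups {D : Bool → (P → X) → ℝ} (hD : ∀ θ, IsProbWeight (D θ)) {l : ℕ}
    {ε : ℝ} (h : AdvantageAtMost Ξ D l ε) {F : (G × P → X) → ℝ} (hF : RoundComputable Ξ l F) :
    |∑ I : G → P → X, prodWeight (fun _ => D true) I * F (fun q => I q.1 q.2) -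
      ∑ I : G → P → X, prodWeight (fun _ => D false) I * F (fun q => I q.1 q.2)| ≤
      Fintype.card G * ε := by
  refine (abs_sum_prodWeight_sub_le (fun _ => hD true) (fun _ => hD false) _ (fun _ => ε)
    fun i I => h _ (hF.restrict i I)).trans ?_
  simp

/-- The conditional weight of the source given the value `m` of a function of it. -/
noncomputable def conditionalWeight {Z Ξ : Type} [Fintype Z] [DecidableEq Ξ] (ν : Z → ℝ)
    (f : Z → Ξ) (m : Ξ) (z : Z) : ℝ :=
  -- For a message of probability zero, `ν` is a default that keeps this a probability weight.
  if pushWeight f ν m = 0 then ν z else (if f z = m then ν z else 0) / pushWeight f ν m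

theorem isProbWeight_conditionalWeight {Z Ξ : Type} [Fintype Z] [Fintype Ξ] [DecidableEq Ξ]
    {ν : Z → ℝ} (hν : IsProbWeight ν) (f : Z → Ξ) (m : Ξ) :
    IsProbWeight (conditionalWeight ν f m) := by
  unfold conditionalWeight
  by_cases h : pushWeight f ν m = 0
  · simpa [h] using hν
  · simp only [h, if_false]
    refine ⟨fun z => div_nonneg ?_ ((hν.push f).nonneg m), ?_⟩
    · split_ifs
      exacts [hν.nonneg z, le_rfl]
    · rw [← Finset.sum_div]
      exact div_self h

theorem pushWeight_mul_conditionalWeight {Z Ξ : Type} [Fintype Z] [DecidableEq Ξ]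
    {ν : Z → ℝ} (hν : IsProbWeight ν) (f : Z → Ξ) (m : Ξ) (z : Z) :
    pushWeight f ν m * conditionalWeight ν f m z = if f z = m then ν z else 0 := by
  unfold conditionalWeight
  by_cases h : pushWeight f ν m = 0
  · have h0 := (Finset.sum_eq_zero_iff_of_nonneg (fun a _ => by
      split_ifs
      exacts [hν.nonneg a, le_rfl])).1 (show ∑ a, (if f a = m then ν a else 0) = 0 from h)
    rw [h, zero_mul, h0 z (Finset.mem_univ z)]
  · rw [if_neg h, mul_div_cancel₀ _ h]

variable [DecidableEq X] {Q : Type} [Fintype Q] [DecidableEq Q]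

/-- Replacing the laws of the first messages by fixed laws, with the private randomness resampled
conditionally on the messages. -/
theorem abs_sum_sub_sum_resampled_le {Z : Type} [Fintype Z] [DecidableEq Z] [Fintype Ξ]
    [DecidableEq Ξ] {ν : Q → Z → ℝ} (hν : ∀ q, IsProbWeight (ν q)) (f : Q → Z → Ξ)
    {K : Q → Ξ → ℝ} (hK : ∀ q, IsProbWeight (K q)) (F : (Q → Ξ) → (Q → Z) → ℝ)
    (hF : ∀ m z, |F m z| ≤ 1) :
    |∑ z, prodWeight ν z * F (fun q => f q (z q)) z -
      ∑ m, prodWeight K m * ∑ z, prodWeight (fun q => conditionalWeight (ν q) (f q) (m q)) z *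
        F m z| ≤ ∑ q, ∑ m, |pushWeight (f q) (ν q) m - K q m| := by
  -- `a` and `b` are joint laws of message and source with the same conditional law of the source,
  -- so their distance is that of the message laws.
  set a : Q → Ξ × Z → ℝ := fun q v => pushWeight (f q) (ν q) v.1 *
    conditionalWeight (ν q) (f q) v.1 v.2 with hadef
  set b : Q → Ξ × Z → ℝ := fun q v => K q v.1 * conditionalWeight (ν q) (f q) v.1 v.2 with hbdef
  have hcond := fun q m => isProbWeight_conditionalWeight (hν q) (f q) m
  have joint : ∀ (L : Ξ → ℝ) (q : Q), IsProbWeight L →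
      IsProbWeight fun v : Ξ × Z => L v.1 * conditionalWeight (ν q) (f q) v.1 v.2 := by
    intro L q hL
    refine ⟨fun v => mul_nonneg (hL.nonneg _) ((hcond q _).nonneg _), ?_⟩
    rw [Fintype.sum_prod_type]
    simp only [← Finset.mul_sum, (hcond q _).sum_eq_one, mul_one, hL.sum_eq_one]
  have ha : ∀ q, IsProbWeight (a q) := fun q => joint _ q ((hν q).push (f q))
  have hb : ∀ q, IsProbWeight (b q) := fun q => joint _ q (hK q)
  have e1 : ∑ z, prodWeight ν z * F (fun q => f q (z q)) z =
      ∑ v, prodWeight a v * F (fun q => (v q).1) (fun q => (v q).2) := by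
    rw [← sum_prodWeight_push ν (fun q z => (f q z, z))
      (fun v : Q → Ξ × Z => F (fun q => (v q).1) (fun q => (v q).2))]
    have : (fun q => pushWeight (fun z => (f q z, z)) (ν q)) = a := by
      funext q v
      simp only [hadef, pushWeight_mul_conditionalWeight (hν q)]
      obtain ⟨m, z⟩ := v
      simp only [pushWeight, Prod.mk.injEq]
      rw [Finset.sum_eq_single z]
      · simp
      · intro z' _ hz; simp [hz]
      · simp
    rw [this]
  have e2 : ∑ m, prodWeight K m * ∑ z, prodWeight (fun q => conditionalWeight (ν q) (f q) (m q)) z *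
        F m z = ∑ v, prodWeight b v * F (fun q => (v q).1) (fun q => (v q).2) := by
    rw [← Equiv.sum_comp (Equiv.arrowProdEquivProdArrow Q (fun _ => Ξ) (fun _ => Z)).symm, Fintype.sum_prod_type]
    refine Finset.sum_congr rfl fun m _ => ?_
    rw [Finset.mul_sum]
    refine Finset.sum_congr rfl fun z _ => ?_
    rw [← mul_assoc]
    congr 1
    simp only [prodWeight, hbdef, ← Finset.prod_mul_distrib]
    rfl
  rw [e1, e2]
  refine abs_sum_prodWeight_sub_le ha hb _ _ fun q v => ?_
  rw [← Finset.sum_sub_distrib]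
  calc _ ≤ ∑ y : Ξ × Z, |a q y - b q y| := by
        refine (Finset.abs_sum_le_sum_abs _ _).trans (Finset.sum_le_sum fun y _ => ?_)
        rw [← sub_mul, abs_mul]
        exact mul_le_of_le_one_right (abs_nonneg _) (hF _ _)
    _ = _ := by
        rw [Fintype.sum_prod_type]
        refine Finset.sum_congr rfl fun m _ => ?_
        simp only [hadef, hbdef, ← sub_mul, abs_mul, abs_of_nonneg ((hcond q m).nonneg _)]
        rw [← Finset.mul_sum, (hcond q m).sum_eq_one, mul_one]

/-- One step of round elimination, for a fixed hidden index `j`. -/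
theorem AdvantageAtMost.abs_sub_le_of_fixed_index [Fintype Ξ] [DecidableEq Ξ]
    {D : Bool → (P → X) → ℝ}
    (hD : ∀ θ, IsProbWeight (D θ)) {l : ℕ} {ε : ℝ} (h : AdvantageAtMost Ξ D l ε)
    {μ : P → X → ℝ} (hμ : ∀ p, IsProbWeight (μ p)) (msg : G × P → (J → X) → Ξ)
    (F : (G × P → Ξ) → (G × P → J → X) → ℝ) (hF : ∀ m, RoundComputable Ξ l (F m)) (j : J) :
    |∑ I : G → P → X, prodWeight (fun _ => D true) I *
        ∑ z, prodWeight (fun q : G × P => prodWeight fun _ : J => μ q.2) z *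
          F (fun q => msg q (Function.update (z q) j (I q.1 q.2)))
            (fun q => Function.update (z q) j (I q.1 q.2)) -
      ∑ I : G → P → X, prodWeight (fun _ => D false) I *
        ∑ z, prodWeight (fun q : G × P => prodWeight fun _ : J => μ q.2) z *
          F (fun q => msg q (Function.update (z q) j (I q.1 q.2)))
            (fun q => Function.update (z q) j (I q.1 q.2))| ≤
      Fintype.card G * ε + ∑ q : G × P, ∑ y, (D true y + D false y) *
        ∑ m, |conditionalLaw (μ q.2) (msg q) j (y q.2) m -
          pushWeight (msg q) (prodWeight fun _ => μ q.2) m| := by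
  set ν : G × P → (J → X) → ℝ := fun q => prodWeight fun _ : J => μ q.2 with hνdef
  have hν : ∀ q, IsProbWeight (ν q) := fun q => IsProbWeight.prodWeight fun _ => hμ q.2
  set K : G × P → Ξ → ℝ := fun q => pushWeight (msg q) (ν q) with hKdef
  have hK : ∀ q, IsProbWeight (K q) := fun q => (hν q).push _
  set κ : (G × P → Ξ) → G × P → X → (J → X) → ℝ := fun m q x =>
    conditionalWeight (ν q) (fun z => msg q (Function.update z j x)) (m q) with hκdef
  have hκ : ∀ m q x, IsProbWeight (κ m q x) :=
    fun m q x => isProbWeight_conditionalWeight (hν q) _ _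
  set A : (G → P → X) → ℝ := fun I => ∑ z, prodWeight ν z *
    F (fun q => msg q (Function.update (z q) j (I q.1 q.2)))
      (fun q => Function.update (z q) j (I q.1 q.2)) with hAdef
  -- The idealised experiment: messages are drawn from laws that ignore the hidden inputs `I`, and
  -- the fillers are then drawn conditionally on these messages and on `I`.
  set C : (G → P → X) → ℝ := fun I => ∑ m, prodWeight K m *
    ∑ z, prodWeight (fun q => κ m q (I q.1 q.2)) z *
      F m (fun q => Function.update (z q) j (I q.1 q.2)) with hCdef
  set L : G × P → (P → X) → ℝ := fun q y => ∑ m, |conditionalLaw (μ q.2) (msg q) j (y q.2) m -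
          pushWeight (msg q) (prodWeight fun _ => μ q.2) m| with hLdef
  have swap : ∀ θ, |∑ I, prodWeight (fun _ => D θ) I * A I -
      ∑ I, prodWeight (fun _ => D θ) I * C I| ≤ ∑ q, ∑ y, D θ y * L q y := by
    intro θ
    have h1 : ∀ I, |A I - C I| ≤ ∑ q, L q (I q.1) := fun I =>
      abs_sum_sub_sum_resampled_le hν (fun q z => msg q (Function.update z j (I q.1 q.2))) hK
        (fun m z => F m (fun q => Function.update (z q) j (I q.1 q.2)))
        fun m z => (hF m).abs_le_one _
    have hprod := IsProbWeight.prodWeight (ι := G) fun _ => hD θ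
    rw [← Finset.sum_sub_distrib]
    calc _ ≤ ∑ I : G → P → X, prodWeight (fun _ => D θ) I * ∑ q, L q (I q.1) := by
          refine (Finset.abs_sum_le_sum_abs _ _).trans (Finset.sum_le_sum fun I _ => ?_)
          rw [← mul_sub, abs_mul, abs_of_nonneg (hprod.nonneg I)]
          exact mul_le_mul_of_nonneg_left (h1 I) (hprod.nonneg I)
      _ = _ := by
          simp only [Finset.mul_sum]
          rw [Finset.sum_comm]
          refine Finset.sum_congr rfl fun q _ => ?_
          exact sum_prodWeight_mul_eval (fun _ => hD θ) q.1 (L q)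
  have ideal : |∑ I, prodWeight (fun _ => D true) I * C I -
      ∑ I, prodWeight (fun _ => D false) I * C I| ≤ Fintype.card G * ε := by
    -- The conditional fillers are realised by random functions `ζ` drawn independently of `I`. Once
    -- `m` and `ζ` are fixed, each player computes its fillers from its own input, so an `l`-round
    -- protocol for `I` is left.
    have e : ∀ θ, ∑ I, prodWeight (fun _ => D θ) I * C I =
        ∑ m, prodWeight K m * ∑ ζ : G × P → X → J → X, prodWeight (fun q => prodWeight (κ m q)) ζ *
          ∑ I, prodWeight (fun _ => D θ) I *
            F m (fun q => Function.update (ζ q (I q.1 q.2)) j (I q.1 q.2)) := by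
      intro θ
      have e1 : ∀ I, C I = ∑ m, prodWeight K m *
          ∑ ζ : G × P → X → J → X, prodWeight (fun q => prodWeight (κ m q)) ζ *
            F m (fun q => Function.update (ζ q (I q.1 q.2)) j (I q.1 q.2)) := by
        intro I
        refine Finset.sum_congr rfl fun m _ => ?_
        congr 1
        exact sum_prodWeight_kernel (hκ m) (fun q => I q.1 q.2)
          (fun z => F m (fun q => Function.update (z q) j (I q.1 q.2)))
      simp only [e1, Finset.mul_sum]
      rw [Finset.sum_comm]
      refine Finset.sum_congr rfl fun m _ => ?_
      rw [Finset.sum_comm]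
      refine Finset.sum_congr rfl fun ζ _ => Finset.sum_congr rfl fun I _ => ?_
      ring
    rw [e, e, ← Finset.sum_sub_distrib]
    simp only [← mul_sub, ← Finset.sum_sub_distrib]
    refine (IsProbWeight.prodWeight hK).abs_sum_le fun m => ?_
    refine (IsProbWeight.prodWeight fun q => IsProbWeight.prodWeight (hκ m q)).abs_sum_le
      fun ζ => ?_
    simp only [Finset.sum_sub_distrib]
    exact h.groups hD ((hF m).comp fun q x => Function.update (ζ q x) j x)
  have s1 := swap true
  have s0 := swap false
  rw [abs_sub_comm] at s0
  have e3 : ∑ q : G × P, ∑ y, (D true y + D false y) * L q y =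
      ∑ q, ∑ y, D true y * L q y + ∑ q, ∑ y, D false y * L q y := by
    simp only [add_mul, Finset.sum_add_distrib]
  rw [e3]
  rw [abs_le] at *
  constructor <;> linarith [s1.1, s1.2, s0.1, s0.2, ideal.1, ideal.2]

/-- The marginal law of the input of `p`, under a uniform choice of one of two distributions. -/
noncomputable def marginal (D : Bool → (P → X) → ℝ) (p : P) : X → ℝ :=
  pushWeight (fun y => y p) fun y => (D true y + D false y) / 2

theorem isProbWeight_marginal {D : Bool → (P → X) → ℝ} (hD : ∀ θ, IsProbWeight (D θ)) (p : P) :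
    IsProbWeight (marginal D p) := by
  refine IsProbWeight.push ⟨fun y => ?_, ?_⟩ _
  · linarith [(hD true).nonneg y, (hD false).nonneg y]
  · rw [← Finset.sum_div, Finset.sum_add_distrib, (hD _).sum_eq_one, (hD _).sum_eq_one]
    norm_num

variable {R Φ X' : Type} [Fintype R] [DecidableEq X']

/-- The weight on the tuples of a seed, the inputs of the groups and the fillers. -/
noncomputable def sourceWeight (D : Bool → (P → X) → ℝ) (θ : Bool)
    (v : R × (G → P → X) × (G × P → J → X)) : ℝ :=
  (Fintype.card R : ℝ)⁻¹ * (prodWeight (fun _ => D θ) v.2.1 *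
    prodWeight (fun q : G × P => prodWeight fun _ : J => marginal D q.2) v.2.2)

/-- The inputs of all the players, with those of the groups hidden at the index `jstar`. -/
def assemble (jstar : R → J) (φ : R → G → Φ) (mk : Φ → (J → X) → X')
    (v : R × (G → P → X) × (G × P → J → X)) : G × P → X' :=
  fun q => mk (φ v.1 q.1) (Function.update (v.2.2 q) (jstar v.1) (v.2.1 q.1 q.2))

/-- The distributions in which independent inputs of the groups are hidden among fillers. -/
noncomputable def hide (jstar : R → J) (φ : R → G → Φ) (mk : Φ → (J → X) → X')
    (D : Bool → (P → X) → ℝ) (θ : Bool) : (G × P → X') → ℝ :=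
  pushWeight (assemble jstar φ mk) (sourceWeight D θ)

theorem isProbWeight_hide [Fintype X'] [Nonempty R] (jstar : R → J) (φ : R → G → Φ) (mk : Φ → (J → X) → X')
    {D : Bool → (P → X) → ℝ} (hD : ∀ θ, IsProbWeight (D θ)) (θ : Bool) :
    IsProbWeight (hide jstar φ mk D θ) := by
  have h1 := IsProbWeight.prodWeight (ι := G) fun _ => hD θ
  have h2 := IsProbWeight.prodWeight (ι := G × P) fun q =>
    IsProbWeight.prodWeight (ι := J) fun _ => isProbWeight_marginal hD q.2
  refine IsProbWeight.push ⟨fun v => ?_, ?_⟩ _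
  · exact mul_nonneg (by positivity) (mul_nonneg (h1.nonneg _) (h2.nonneg _))
  · simp only [sourceWeight, Fintype.sum_prod_type, ← Finset.mul_sum, h2.sum_eq_one, mul_one,
      h1.sum_eq_one]
    simp

/-- A filler may come from the law of the other answer; only the tuples at the hidden index are
guaranteed to lie in the support for `θ`. -/
theorem exists_of_hide_ne_zero {jstar : R → J} {φ : R → G → Φ} {mk : Φ → (J → X) → X'}
    {D : Bool → (P → X) → ℝ} {θ : Bool} {y : G × P → X'} (hy : hide jstar φ mk D θ y ≠ 0) :
    ∃ (ρ : R) (x : G × P → J → X), (∀ i, D θ (fun p => x (i, p) (jstar ρ)) ≠ 0) ∧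
      (∀ q j, ∃ θ' y', D θ' y' ≠ 0 ∧ y' q.2 = x q j) ∧ y = fun q => mk (φ ρ q.1) (x q) := by
  obtain ⟨⟨ρ, I, z⟩, h, rfl⟩ := exists_of_pushWeight_ne_zero hy
  simp only [sourceWeight, prodWeight] at h
  have h1 := left_ne_zero_of_mul (right_ne_zero_of_mul h)
  have h2 := right_ne_zero_of_mul (right_ne_zero_of_mul h)
  have hI : ∀ i, D θ (I i) ≠ 0 := fun i => Finset.prod_ne_zero_iff.1 h1 i (Finset.mem_univ i)
  refine ⟨ρ, fun q => Function.update (z q) (jstar ρ) (I q.1 q.2), fun i => ?_, fun q j => ?_, rfl⟩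
  · simpa using hI i
  · by_cases hj : j = jstar ρ
    · subst hj
      exact ⟨θ, I q.1, hI _, by simp⟩
    · have h3 := Finset.prod_ne_zero_iff.1 (Finset.prod_ne_zero_iff.1 h2 q (Finset.mem_univ q)) j
        (Finset.mem_univ j)
      obtain ⟨y', hy', e⟩ := exists_of_pushWeight_ne_zero h3
      by_cases h4 : D true y' = 0
      · refine ⟨false, y', fun h5 => hy' (by simp [h4, h5]), by simp [hj, e]⟩
      · exact ⟨true, y', h4, by simp [hj, e]⟩

/-- **Round elimination.** -/
theorem AdvantageAtMost.hide [Fintype X'] [Fintype Ξ] [DecidableEq Ξ] [Nonempty R]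
    {D : Bool → (P → X) → ℝ} (hD : ∀ θ, IsProbWeight (D θ)) {l : ℕ} {ε : ℝ}
    (h : AdvantageAtMost Ξ D l ε) (jstar : R → J) (φ : R → G → Φ) (mk : Φ → (J → X) → X')
    (hind : ∀ (i : G) (f : J → Φ → ℝ), ∑ ρ, f (jstar ρ) (φ ρ i) =
      ∑ ρ, (Fintype.card J : ℝ)⁻¹ * ∑ j, f j (φ ρ i))
    {A t : ℝ} (ht0 : 0 < t) (ht : t ≤ 1 / 2) (hA : Real.log (Fintype.card Ξ) ≤ A) :
    AdvantageAtMost Ξ (hide jstar φ mk D) (l + 1) (Fintype.card G * ε +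
      2 * (Fintype.card G * Fintype.card P) * (A / (t * Fintype.card J) + 4 * t)) := by
  rintro F ⟨msg, F', hF', hF⟩
  have hJ : 0 < (Fintype.card J : ℝ) := by
    have : Nonempty J := ‹Nonempty R›.map jstar
    exact_mod_cast Fintype.card_pos
  have hR : 0 < (Fintype.card R : ℝ) := by exact_mod_cast Fintype.card_pos
  set E : Bool → R → ℝ := fun θ ρ => ∑ I : G → P → X, prodWeight (fun _ => D θ) I *
    ∑ z, prodWeight (fun q : G × P => prodWeight fun _ : J => marginal D q.2) z *
      F' (fun q => msg q (mk (φ ρ q.1) (Function.update (z q) (jstar ρ) (I q.1 q.2))))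
        (fun q => mk (φ ρ q.1) (Function.update (z q) (jstar ρ) (I q.1 q.2))) with hE
  have e1 : ∀ θ, ∑ x, _root_.hide jstar φ mk D θ x * F x =
      (Fintype.card R : ℝ)⁻¹ * ∑ ρ, E θ ρ := by
    intro θ
    simp only [_root_.hide]
    rw [sum_pushWeight_mul]
    simp only [sourceWeight, Fintype.sum_prod_type, hE, Finset.mul_sum]
    refine Finset.sum_congr rfl fun ρ _ => Finset.sum_congr rfl fun I _ =>
      Finset.sum_congr rfl fun z _ => ?_
    rw [hF]
    unfold assemble
    ring
  -- The factor 2 appears because the two laws sum to twice the mixture whose marginal is the filler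
  -- law; this lets a single influence bound serve both answers.
  set L : G × P → J → Φ → ℝ := fun q j c => ∑ x, 2 * (marginal D q.2 x *
    ∑ m, |conditionalLaw (marginal D q.2) (fun z => msg q (mk c z)) j x m -
          pushWeight (fun z => msg q (mk c z)) (prodWeight fun _ => marginal D q.2) m|) with hL
  have e2 : ∀ ρ, |E true ρ - E false ρ| ≤ Fintype.card G * ε +
      ∑ q : G × P, L q (jstar ρ) (φ ρ q.1) := by
    intro ρ
    have := h.abs_sub_le_of_fixed_index hD (isProbWeight_marginal hD)
      (fun (q : G × P) z => msg q (mk (φ ρ q.1) z)) (fun m y => F' m fun q => mk (φ ρ q.1) (y q))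
      (fun m => (hF' m).comp fun q y => mk (φ ρ q.1) y) (jstar ρ)
    refine this.trans (le_of_eq ?_)
    congr 1
    refine Finset.sum_congr rfl fun q _ => ?_
    simp only [hL]
    rw [← Finset.mul_sum]
    conv_rhs => enter [2]; simp only [marginal]
    rw [sum_pushWeight_mul, Finset.mul_sum]
    refine Finset.sum_congr rfl fun y _ => ?_
    simp only [marginal]
    ring
  have e3 : ∀ q : G × P, ∑ ρ, L q (jstar ρ) (φ ρ q.1) ≤
      Fintype.card R * (2 * (A / (t * Fintype.card J) + 4 * t)) := by
    intro q
    -- The first message of `q` depends only on the labels of its own group, which are independent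
    -- of the hidden index. The index can therefore be averaged over `J`, as the influence bound
    -- requires.
    rw [hind q.1 (L q)]
    rw [← nsmul_eq_mul]
    refine (Finset.sum_le_card_nsmul Finset.univ _ _ fun ρ _ => ?_).trans_eq
      (by rw [Finset.card_univ])
    have := sum_influence_le (isProbWeight_marginal hD q.2) (fun z : J → X => msg q (mk (φ ρ q.1) z))
      ht0 ht hA
    rw [inv_mul_le_iff₀ hJ]
    simp only [hL, ← Finset.mul_sum]
    have e : (Fintype.card J : ℝ) * (2 * (A / (t * Fintype.card J) + 4 * t)) =
        2 * (A / t + 4 * t * Fintype.card J) := by field_simp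
    rw [e]
    linarith
  rw [e1, e1, ← mul_sub, ← Finset.sum_sub_distrib, abs_mul, abs_of_pos (inv_pos.2 hR),
    inv_mul_le_iff₀ hR]
  calc _ ≤ ∑ ρ, (Fintype.card G * ε + ∑ q : G × P, L q (jstar ρ) (φ ρ q.1)) :=
        (Finset.abs_sum_le_sum_abs _ _).trans (Finset.sum_le_sum fun ρ _ => e2 ρ)
    _ = Fintype.card R * (Fintype.card G * ε) + ∑ q : G × P, ∑ ρ, L q (jstar ρ) (φ ρ q.1) := by
        rw [Finset.sum_add_distrib, Finset.sum_comm]; simp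
    _ ≤ Fintype.card R * (Fintype.card G * ε) +
        ∑ _q : G × P, Fintype.card R * (2 * (A / (t * Fintype.card J) + 4 * t)) := by
        gcongr with q; exact e3 q
    _ = _ := by
        rw [Finset.sum_const, Finset.card_univ, Fintype.card_prod, nsmul_eq_mul]
        push_cast; ring

end Elimination

/-! ### The universe of one level and its combinatorics. -/

section Layer

variable {E C G J P S : Type} [DecidableEq C] [AddCommGroup C]

/-- The universe of the next level: a common part, and a copy of `E` for every group. -/
abbrev Layer (E C G : Type) [AddCommGroup C] : Type := (E × {a : C // a ≠ 0}) ⊕ (G × E)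

/-- The colour of an element of the next level. -/
def layerColor (col : E → C) : Layer E C G → C :=
  Sum.elim (fun v => col v.1) fun v => col v.2

/-- The placement of `E × C` in which `E × {0}` is the copy of `E` that belongs to the group `i`,
and the rest is the common part. -/
def place (i : G) (v : E × C) : Layer E C G :=
  if h : v.2 = 0 then Sum.inr (i, v.1) else Sum.inl (v.1, ⟨v.2, h⟩)

theorem place_injective (i : G) : Function.Injective (place i : E × C → Layer E C G) := by
  rintro ⟨u, a⟩ ⟨u', a'⟩ h
  by_cases h1 : a = 0 <;> by_cases h2 : a' = 0 <;> simp_all [place]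

theorem layerColor_place (col : E → C) (i : G) (v : E × C) :
    layerColor col (place i v : Layer E C G) = col v.1 := by
  unfold place layerColor
  split_ifs <;> rfl

/-- The permutations that preserve the colours. -/
abbrev ColorPerm {U C : Type} (col : U → C) : Type :=
  {σ : Equiv.Perm U // ∀ u, col (σ u) = col u}

instance {U C : Type} (col : U → C) : Nonempty (ColorPerm col) := ⟨⟨1, fun _ => rfl⟩⟩

/-- The labels that the group `i` uses: those with `v.2 = f j (col v.1)`, for the hidden index `j`,
belong to the group alone. -/
def relabel (col : E → C) (f : J → C → C) (ρ : J × ColorPerm (layerColor (G := G) col)) (i : G)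
    (v : E × C) : Layer E C G :=
  ρ.2.1 (place i (v.1, v.2 - f ρ.1 (col v.1)))

theorem layerColor_relabel (col : E → C) (f : J → C → C)
    (ρ : J × ColorPerm (layerColor (G := G) col)) (i : G) (v : E × C) :
    layerColor col (relabel col f ρ i v) = col v.1 := by
  rw [relabel, ρ.2.2, layerColor_place]

theorem relabel_graph (col : E → C) (f : J → C → C)
    (ρ : J × ColorPerm (layerColor (G := G) col)) (i : G) (u : E) :
    relabel col f ρ i (u, f ρ.1 (col u)) = ρ.2.1 (Sum.inr (i, u)) := by
  simp [relabel, place]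

/-- The permutation of `E × C` that translates by a function of the colour. -/
def shear (col : E → C) (s : C → C) : Equiv.Perm (E × C) where
  toFun v := (v.1, v.2 + s (col v.1))
  invFun v := (v.1, v.2 - s (col v.1))
  left_inv v := by simp
  right_inv v := by simp

theorem layerColor_viaEmbedding (col : E → C) (s : C → C) (i : G) (u : Layer E C G) :
    layerColor col ((shear col s).viaEmbedding ⟨place i, place_injective i⟩ u) =
      layerColor col u := by
  by_cases h : u ∈ Set.range (⟨place i, place_injective i⟩ : E × C ↪ Layer E C G)
  · obtain ⟨v, rfl⟩ := h
    rw [Equiv.Perm.viaEmbedding_apply]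
    exact (layerColor_place col i (shear col s v)).trans (layerColor_place col i v).symm
  · rw [Equiv.Perm.viaEmbedding_apply_of_notMem _ _ _ h]

variable [DecidableEq E] [DecidableEq G]

/-- The sets that a player sees: copies of the families `x j`, along the graphs of the `f j`. -/
def spread (col : E → C) (f : J → C → C) (φ : E × C → Layer E C G) (x : J → S → Finset E) :
    J × S → Finset (Layer E C G) :=
  fun v => (x v.1 v.2).image fun u => φ (u, f v.1 (col u))

/-- The sets `y p s` with `(p, s) ∈ T` cover at most `Δ + d * |T|` elements. -/
def CoverBound {U : Type} [DecidableEq U] (y : P → S → Finset U) (Δ d : ℕ) : Prop :=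
  ∀ T : Finset (P × S), (T.biUnion fun v => y v.1 v.2).card ≤ Δ + d * T.card

/-- Some choice of one set for each player covers `N` elements. -/
def CoversAtLeast [Fintype P] {U : Type} [DecidableEq U] (y : P → S → Finset U) (N : ℕ) : Prop :=
  ∃ s : P → S, N ≤ (Finset.univ.biUnion fun p => y p (s p)).card

theorem injOn_spread {col : E → C} {f : J → C → C} {x : J → S → Finset E}
    (hx : ∀ j s, Set.InjOn col (x j s)) (ρ : J × ColorPerm (layerColor (G := G) col)) (i : G)
    (v : J × S) :
    Set.InjOn (layerColor col) (spread col f (relabel col f ρ i) x v : Set (Layer E C G)) := by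
  intro a ha b hb hab
  simp only [spread, Finset.coe_image, Set.mem_image] at ha hb
  obtain ⟨u, hu, rfl⟩ := ha
  obtain ⟨u', hu', rfl⟩ := hb
  rw [layerColor_relabel, layerColor_relabel] at hab
  rw [hx _ _ hu hu' hab]

/-- Every player uses a set of the hidden family. The private regions of distinct groups are
disjoint, so the covered numbers add up. -/
theorem coversAtLeast_spread [Fintype P] [Fintype G] {col : E → C} {f : J → C → C}
    (ρ : J × ColorPerm (layerColor (G := G) col)) (x : G × P → J → S → Finset E) {N : ℕ}
    (h : ∀ i, CoversAtLeast (fun p => x (i, p) ρ.1) N) :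
    CoversAtLeast (fun q : G × P => spread col f (relabel col f ρ q.1) (x q))
      (Fintype.card G * N) := by
  choose s hs using h
  refine ⟨fun q => (ρ.1, s q.1 q.2), ?_⟩
  set W : G → Finset E := fun i => Finset.univ.biUnion fun p => x (i, p) ρ.1 (s i p) with hW
  have hinj : ∀ i, Function.Injective fun u : E => ρ.2.1 (Sum.inr (i, u)) := fun i u u' h => by
    simpa using h
  calc Fintype.card G * N ≤ ∑ i, (W i).card := by
        rw [← smul_eq_mul, ← Finset.card_univ]
        exact Finset.card_nsmul_le_sum _ _ _ fun i _ => hs i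
    _ = ∑ i, ((W i).image fun u => ρ.2.1 (Sum.inr (i, u))).card :=
        Finset.sum_congr rfl fun i _ => (Finset.card_image_of_injective _ (hinj i)).symm
    _ = (Finset.univ.biUnion fun i => (W i).image fun u => ρ.2.1 (Sum.inr (i, u))).card := by
        rw [Finset.card_biUnion]
        intro i _ i' _ hii
        rw [Function.onFun, Finset.disjoint_left]
        intro a ha ha'
        simp only [Finset.mem_image] at ha ha'
        obtain ⟨u, -, rfl⟩ := ha
        obtain ⟨u', -, h⟩ := ha'
        simp only [EmbeddingLike.apply_eq_iff_eq, Sum.inr.injEq, Prod.mk.injEq] at h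
        exact hii h.1.symm
    _ ≤ _ := by
        refine Finset.card_le_card ?_
        intro a ha
        simp only [Finset.mem_biUnion, Finset.mem_image, Finset.mem_univ, true_and, hW] at ha
        obtain ⟨i, u, ⟨p, hp⟩, rfl⟩ := ha
        simp only [Finset.mem_biUnion, Finset.mem_univ, true_and, spread, Finset.mem_image]
        exact ⟨(i, p), u, hp, relabel_graph _ _ _ _ _⟩

variable [Fintype E] [Fintype C] [Fintype G]

/-- The labels of a group are independent of the hidden index. -/
theorem sum_relabel_eq [Fintype J] [DecidableEq J] (col : E → C) (f : J → C → C) (i : G)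
    (F : J → (E × C → Layer E C G) → ℝ) :
    ∑ ρ : J × ColorPerm (layerColor (G := G) col), F ρ.1 (relabel col f ρ i) =
      ∑ ρ : J × ColorPerm (layerColor (G := G) col), (Fintype.card J : ℝ)⁻¹ *
        ∑ j, F j (relabel col f ρ i) := by
  have key : ∀ j j' : J, ∑ σ : ColorPerm (layerColor (G := G) col),
      F j' (relabel col f (j, σ) i) = ∑ σ, F j' (relabel col f (j', σ) i) := by
    intro j j'
    -- The shear of the region of group `i` carries the placement for `j` to the one for `j'` and
    -- preserves colours, so composing with it leaves the uniform permutation uniform.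
    set τ : Equiv.Perm (Layer E C G) :=
      (shear col fun c => f j c - f j' c).viaEmbedding ⟨place i, place_injective i⟩ with hτ
    have hc : ∀ u, layerColor col (τ u) = layerColor col u := layerColor_viaEmbedding col _ i
    have hc' : ∀ u, layerColor col (τ.symm u) = layerColor col u := fun u => by
      rw [← hc (τ.symm u), Equiv.apply_symm_apply]
    let e : ColorPerm (layerColor (G := G) col) ≃ ColorPerm (layerColor (G := G) col) :=
      { toFun := fun σ => ⟨τ.trans σ.1, fun u => by rw [Equiv.trans_apply, σ.2, hc]⟩
        invFun := fun σ => ⟨τ.symm.trans σ.1, fun u => by rw [Equiv.trans_apply, σ.2, hc']⟩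
        left_inv := fun σ => by ext; simp
        right_inv := fun σ => by ext; simp }
    rw [← Equiv.sum_comp e]
    refine Finset.sum_congr rfl fun σ _ => ?_
    congr 1
    funext v
    have h1 : τ (place i (v.1, v.2 - f j (col v.1))) = place i (v.1, v.2 - f j' (col v.1)) := by
      have := Equiv.Perm.viaEmbedding_apply (shear col fun c => f j c - f j' c)
        (⟨place i, place_injective i⟩ : E × C ↪ Layer E C G) (v.1, v.2 - f j (col v.1))
      refine this.trans ?_
      simp [shear]
    simp only [relabel, e, Equiv.coe_fn_mk, Equiv.trans_apply, h1]
  rw [Fintype.sum_prod_type, Fintype.sum_prod_type]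
  rcases isEmpty_or_nonempty J with hJ | hJ
  · simp
  have hJ0 : (Fintype.card J : ℝ) ≠ 0 := by simp
  have e1 : ∀ j, ∑ σ : ColorPerm (layerColor (G := G) col), (Fintype.card J : ℝ)⁻¹ *
      ∑ j', F j' (relabel col f (j, σ) i) =
      (Fintype.card J : ℝ)⁻¹ * ∑ j', ∑ σ, F j' (relabel col f (j', σ) i) := by
    intro j
    rw [← Finset.mul_sum, Finset.sum_comm]
    simp only [key j]
  simp only [e1]
  rw [Finset.sum_const, Finset.card_univ, nsmul_eq_mul, mul_inv_cancel_left₀ hJ0]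

/-- Covered elements are of three kinds: the common region, paid for once; the at most `d` elements
outside it of each set with a wrong index; and elements covered by hidden families, bounded group by
group by `h`. The terms `d` per set then add up to `d` times the number of sets. -/
theorem coverBound_spread [DecidableEq P] [DecidableEq S] [DecidableEq J]
    {col : E → C} {f : J → C → C} {d : ℕ}
    (hf : ∀ j j', j ≠ j' → (Finset.univ.filter fun c => f j c = f j' c).card ≤ d)
    (ρ : J × ColorPerm (layerColor (G := G) col)) (x : G × P → J → S → Finset E)
    (hx : ∀ q j s, Set.InjOn col (x q j s)) {Δ : ℕ}
    (h : ∀ i, CoverBound (fun p => x (i, p) ρ.1) Δ d) :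
    CoverBound (fun q : G × P => spread col f (relabel col f ρ q.1) (x q))
      (Fintype.card E * (Fintype.card C - 1) + Fintype.card G * Δ) d := by
  intro T
  set y : (G × P) × (J × S) → Finset (Layer E C G) :=
    fun v => spread col f (relabel col f ρ v.1.1) (x v.1) v.2 with hy
  set A : Finset (Layer E C G) :=
    Finset.univ.image fun v : E × {a : C // a ≠ 0} => ρ.2.1 (Sum.inl v) with hA
  set T0 := T.filter fun v => v.2.1 ≠ ρ.1 with hT0
  set T1 := T.filter fun v => v.2.1 = ρ.1 with hT1
  have hcard : T.card = T1.card + ∑ _v ∈ T0, 1 := by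
    rw [← Finset.card_eq_sum_ones, hT0, hT1, Finset.card_filter_add_card_filter_not]
  have hT1card : T1.card = ∑ i : G, (T1.filter fun v => v.1.1 = i).card :=
    Finset.card_eq_sum_card_fiberwise fun _ _ => Finset.mem_univ _
  have hsub : T.biUnion y ⊆ (A ∪ T0.biUnion fun v => y v \ A) ∪
      Finset.univ.biUnion fun i => (T1.filter fun v => v.1.1 = i).biUnion y := by
    intro a ha
    obtain ⟨v, hv, ha⟩ := Finset.mem_biUnion.1 ha
    by_cases h1 : v.2.1 = ρ.1
    · refine Finset.mem_union_right _ (Finset.mem_biUnion.2 ⟨v.1.1, Finset.mem_univ _,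
        Finset.mem_biUnion.2 ⟨v, ?_, ha⟩⟩)
      simp [hT1, hv, h1]
    · refine Finset.mem_union_left _ ?_
      by_cases h2 : a ∈ A
      · exact Finset.mem_union_left _ h2
      · refine Finset.mem_union_right _ (Finset.mem_biUnion.2 ⟨v, ?_, ?_⟩)
        · simp [hT0, hv, h1]
        · exact Finset.mem_sdiff.2 ⟨ha, h2⟩
  have hAcard : A.card ≤ Fintype.card E * (Fintype.card C - 1) := by
    refine Finset.card_image_le.trans ?_
    rw [Finset.card_univ, Fintype.card_prod, Fintype.card_subtype_compl, Fintype.card_subtype_eq]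
  -- Elements outside the common region have a colour where `f` at the two indices agrees, and the
  -- colour is injective on the set.
  have hns : ∀ v ∈ T0, (y v \ A).card ≤ d := by
    intro v hv
    have hv1 : v.2.1 ≠ ρ.1 := (Finset.mem_filter.1 hv).2
    refine le_trans ?_ (hf _ _ hv1)
    refine Finset.card_le_card_of_injOn (layerColor col) ?_
      ((injOn_spread (hx v.1) ρ v.1.1 v.2).mono fun a ha => (Finset.mem_sdiff.1 ha).1)
    intro a ha
    obtain ⟨ha1, ha2⟩ := Finset.mem_sdiff.1 (Finset.mem_coe.1 ha)
    simp only [hy, spread, Finset.mem_image] at ha1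
    obtain ⟨u, hu, rfl⟩ := ha1
    simp only [layerColor_relabel, Finset.coe_filter, Finset.mem_univ, true_and, Set.mem_ofPred_eq]
    by_contra hne
    refine ha2 (Finset.mem_image.2 ⟨(u, ⟨_, sub_ne_zero.2 hne⟩), Finset.mem_univ _, ?_⟩)
    simp [relabel, place, sub_ne_zero.2 hne]
  have hsp : ∀ i : G, ((T1.filter fun v => v.1.1 = i).biUnion y).card ≤
      Δ + d * (T1.filter fun v => v.1.1 = i).card := by
    intro i
    set Ti := T1.filter fun v => v.1.1 = i with hTi
    have h1 : Ti.biUnion y ⊆ ((Ti.image fun v => (v.1.2, v.2.2)).biUnion fun w =>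
        x (i, w.1) ρ.1 w.2).image fun u => ρ.2.1 (Sum.inr (i, u)) := by
      intro a ha
      obtain ⟨⟨⟨i', p⟩, j, s⟩, hv, hav⟩ := Finset.mem_biUnion.1 ha
      simp only [hTi, hT1, Finset.mem_filter] at hv
      obtain ⟨⟨hv0, rfl⟩, rfl⟩ := hv
      obtain ⟨u, hu, rfl⟩ := Finset.mem_image.1 hav
      refine Finset.mem_image.2 ⟨u, Finset.mem_biUnion.2 ⟨(p, s), Finset.mem_image.2
        ⟨((i', p), (ρ.1, s)), ?_, rfl⟩, hu⟩, (relabel_graph _ _ _ _ _).symm⟩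
      simp [hTi, hT1, hv0]
    calc _ ≤ _ := (Finset.card_le_card h1).trans Finset.card_image_le
      _ ≤ Δ + d * (Ti.image fun v => (v.1.2, v.2.2)).card := h i _
      _ ≤ Δ + d * Ti.card := by gcongr; exact Finset.card_image_le
  calc (T.biUnion y).card ≤ (A.card + ∑ v ∈ T0, (y v \ A).card) +
        ∑ i, ((T1.filter fun v => v.1.1 = i).biUnion y).card := by
        refine (Finset.card_le_card hsub).trans ((Finset.card_union_le _ _).trans ?_)
        exact add_le_add ((Finset.card_union_le _ _).trans
          (add_le_add le_rfl Finset.card_biUnion_le)) Finset.card_biUnion_le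
    _ ≤ (Fintype.card E * (Fintype.card C - 1) + ∑ _v ∈ T0, d) +
        ∑ i : G, (Δ + d * (T1.filter fun v => v.1.1 = i).card) :=
        add_le_add (add_le_add hAcard (Finset.sum_le_sum hns)) (Finset.sum_le_sum fun i _ => hsp i)
    _ = _ := by
        rw [hcard, Finset.sum_add_distrib, ← Finset.mul_sum, ← hT1card]
        simp only [Finset.sum_const, Finset.card_univ, smul_eq_mul]
        ring

end Layer

/-! ### The recursive hard distribution. -/

/-- A pair of distributions of families of coloured sets, held by several players. -/
structure CoverDistribution (C : Type) : Type 1 where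
  Player : Type
  Index : Type
  Elem : Type
  [fintypePlayer : Fintype Player]
  [decidableEqPlayer : DecidableEq Player]
  [fintypeIndex : Fintype Index]
  [decidableEqIndex : DecidableEq Index]
  [fintypeElem : Fintype Elem]
  [decidableEqElem : DecidableEq Elem]
  color : Elem → C
  law : Bool → (Player → Index → Finset Elem) → ℝ
  isProbWeight_law : ∀ θ, IsProbWeight (law θ)

namespace CoverDistribution

attribute [instance] fintypePlayer decidableEqPlayer fintypeIndex decidableEqIndex fintypeElem
  decidableEqElem

variable {C G J : Type} [Fintype C] [DecidableEq C] [Fintype G] [DecidableEq G]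
  [Fintype J] [DecidableEq J]

/-- One player with one set, which is full or empty. -/
noncomputable def base (C : Type) [Fintype C] [DecidableEq C] : CoverDistribution C where
  Player := Unit
  Index := Unit
  Elem := C
  color := id
  law θ y := if y = (fun _ _ => if θ then Finset.univ else ∅) then 1 else 0
  isProbWeight_law θ := ⟨fun y => by split_ifs <;> norm_num, by simp⟩

/-- Every set in the support of the laws has at most one element of each colour. -/
def Rainbow (c : CoverDistribution C) : Prop :=
  ∀ θ y, c.law θ y ≠ 0 → ∀ p s, Set.InjOn c.color (y p s : Set c.Elem)

theorem rainbow_base : (base C).Rainbow := fun _ _ _ _ _ => Function.Injective.injOn fun _ _ h => h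

variable [AddCommGroup C]

/-- Hiding independent copies of a pair of distributions, one for each group. -/
noncomputable def step (G : Type) [Fintype G] [DecidableEq G] [Nonempty J] (f : J → C → C)
    (c : CoverDistribution C) : CoverDistribution C where
  Player := G × c.Player
  Index := J × c.Index
  Elem := Layer c.Elem C G
  color := layerColor c.color
  law := hide (G := G) (P := c.Player) (J := J) (X := c.Index → Finset c.Elem)
    (R := J × ColorPerm (layerColor (G := G) c.color)) Prod.fst (relabel c.color f)
    (spread c.color f) c.law
  isProbWeight_law := isProbWeight_hide _ _ _ c.isProbWeight_law

theorem exists_of_law_step_ne_zero [Nonempty J] {f : J → C → C} {c : CoverDistribution C}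
    {θ : Bool} {y} (hy : (step G f c).law θ y ≠ 0) :
    ∃ (ρ : J × ColorPerm (layerColor (G := G) c.color))
      (x : G × c.Player → J → c.Index → Finset c.Elem),
      (∀ i, c.law θ (fun p => x (i, p) ρ.1) ≠ 0) ∧
      (∀ q j, ∃ θ' y', c.law θ' y' ≠ 0 ∧ y' q.2 = x q j) ∧
      y = fun q => spread c.color f (relabel c.color f ρ q.1) (x q) :=
  exists_of_hide_ne_zero hy

theorem Rainbow.step [Nonempty J] {f : J → C → C} {c : CoverDistribution C} (hc : c.Rainbow) :
    (step G f c).Rainbow := by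
  intro θ y hy q v
  obtain ⟨ρ, x, -, h2, rfl⟩ := exists_of_law_step_ne_zero hy
  refine injOn_spread (fun j s => ?_) ρ q.1 v
  obtain ⟨θ', y', h, e⟩ := h2 q j
  rw [← e]
  exact hc θ' y' h _ _

theorem coverBound_step [Nonempty J] {f : J → C → C} {c : CoverDistribution C} (hc : c.Rainbow)
    {d Δ : ℕ} (hf : ∀ j j', j ≠ j' → (Finset.univ.filter fun c => f j c = f j' c).card ≤ d)
    {θ : Bool} (h : ∀ y, c.law θ y ≠ 0 → CoverBound y Δ d) (y) (hy : (step G f c).law θ y ≠ 0) :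
    CoverBound y (Fintype.card c.Elem * (Fintype.card C - 1) + Fintype.card G * Δ) d := by
  obtain ⟨ρ, x, h1, h2, rfl⟩ := exists_of_law_step_ne_zero hy
  refine coverBound_spread hf ρ x (fun q j s => ?_) fun i => h _ (h1 i)
  obtain ⟨θ', y', h, e⟩ := h2 q j
  rw [← e]
  exact hc θ' y' h _ _

theorem coversAtLeast_step [Nonempty J] {f : J → C → C} {c : CoverDistribution C} {N : ℕ}
    {θ : Bool} (h : ∀ y, c.law θ y ≠ 0 → CoversAtLeast y N) (y)
    (hy : (step G f c).law θ y ≠ 0) : CoversAtLeast y (Fintype.card G * N) := by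
  obtain ⟨ρ, x, h1, h2, rfl⟩ := exists_of_law_step_ne_zero hy
  exact coversAtLeast_spread ρ x fun i => h _ (h1 i)

/-- The hard distribution for `l` rounds. -/
noncomputable def hard (G : Type) [Fintype G] [DecidableEq G] [Nonempty J] (f : J → C → C) :
    ℕ → CoverDistribution C
  | 0 => base C
  | l + 1 => step G f (hard G f l)

variable [Nonempty J] (f : J → C → C) (l : ℕ)

theorem card_player_hard : Fintype.card (hard G f l).Player = Fintype.card G ^ l := by
  induction l with
  | zero => rfl
  | succ l ih =>
    rw [pow_succ', ← ih]
    exact Fintype.card_prod _ _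

theorem card_index_hard : Fintype.card (hard G f l).Index = Fintype.card J ^ l := by
  induction l with
  | zero => rfl
  | succ l ih =>
    rw [pow_succ', ← ih]
    exact Fintype.card_prod _ _

theorem card_elem_hard : Fintype.card (hard G f l).Elem =
    Fintype.card C * (Fintype.card C - 1 + Fintype.card G) ^ l := by
  induction l with
  | zero => exact (mul_one _).symm
  | succ l ih =>
    have h : Fintype.card (hard G f (l + 1)).Elem =
        Fintype.card (Layer (hard G f l).Elem C G) := rfl
    rw [h, Fintype.card_sum, Fintype.card_prod, Fintype.card_prod, Fintype.card_subtype_compl,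
      Fintype.card_subtype_eq, ih]
    ring

theorem rainbow_hard : (hard G f l).Rainbow := by
  induction l with
  | zero => exact rainbow_base
  | succ l ih => exact ih.step

theorem coversAtLeast_hard (y) (hy : (hard G f l).law true y ≠ 0) :
    CoversAtLeast y (Fintype.card C * Fintype.card G ^ l) := by
  induction l with
  | zero =>
    refine ⟨fun _ => (), ?_⟩
    have : y = fun _ _ => Finset.univ := by
      by_contra h
      exact hy (if_neg h)
    subst this
    rw [pow_zero, mul_one]
    exact Finset.card_le_card fun a _ =>
      Finset.mem_biUnion.2 ⟨(), Finset.mem_univ _, Finset.mem_univ _⟩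
  | succ l ih =>
    have := coversAtLeast_step ih y hy
    rwa [pow_succ', mul_left_comm]

/-- The recursion is Δ' = |E|(q-1) + gΔ. Enlarging the factor g to q-1+g makes all levels contribute
equally, which gives the closed form. The truncated exponent at level 0 is harmless because of the
factor `l`. -/
theorem coverBound_hard {d : ℕ}
    (hf : ∀ j j', j ≠ j' → (Finset.univ.filter fun c => f j c = f j' c).card ≤ d)
    (y) (hy : (hard G f l).law false y ≠ 0) :
    CoverBound y (l * (Fintype.card C * (Fintype.card C - 1) *
      (Fintype.card C - 1 + Fintype.card G) ^ (l - 1))) d := by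
  induction l with
  | zero =>
    intro T
    have : y = fun _ _ => ∅ := by
      by_contra h
      exact hy (if_neg h)
    subst this
    have : (T.biUnion fun v => (∅ : Finset (hard G f 0).Elem)) = ∅ := by
      ext; simp
    rw [this]
    exact Nat.zero_le _
  | succ l ih =>
    intro T
    refine (coverBound_step (rainbow_hard f l) hf ih y hy T).trans ?_
    refine Nat.add_le_add_right ?_ _
    rw [card_elem_hard]
    set q := Fintype.card C
    set g := Fintype.card G
    rcases l with _ | l
    · simp
    · simp only [Nat.add_sub_cancel]
      calc _ ≤ q * (q - 1 + g) ^ (l + 1) * (q - 1) +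
            (q - 1 + g) * ((l + 1) * (q * (q - 1) * (q - 1 + g) ^ l)) := by
            gcongr; omega
        _ = _ := by ring

/-- Protocols with few rounds and short messages have a small advantage. -/
theorem advantageAtMost_hard {Ξ : Type} [Fintype Ξ] [DecidableEq Ξ] {A t : ℝ} (ht0 : 0 < t)
    (ht : t ≤ 1 / 2) (hA : Real.log (Fintype.card Ξ) ≤ A) :
    AdvantageAtMost Ξ (hard G f l).law l (2 * l * (Fintype.card G : ℝ) ^ l *
      (A / (t * Fintype.card J) + 4 * t)) := by
  induction l with
  | zero => exact (advantageAtMost_zero (base C).isProbWeight_law).mono (by simp)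
  | succ l ih =>
    have h := AdvantageAtMost.hide (hard G f l).isProbWeight_law ih
      (R := J × ColorPerm (layerColor (G := G) (hard G f l).color)) Prod.fst
      (relabel (hard G f l).color f) (spread (hard G f l).color f)
      (fun i F => sum_relabel_eq (hard G f l).color f i F) ht0 ht hA
    rw [card_player_hard] at h
    -- The recursion multiplies by g and adds 2g^(l+1) times the loss per player, so each level
    -- contributes the same amount after division by g^(l+1).
    refine AdvantageAtMost.mono h (le_of_eq ?_)
    push_cast
    ring

end CoverDistribution

/-! ### From randomized blackboard protocols to bounded deterministic ones. -/

/-- The bit strings with at most `B` bits. -/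
abbrev ShortString (B : ℕ) : Type := {s : List Bool // s.length ≤ B}

noncomputable instance (B : ℕ) : Fintype (ShortString B) := (List.finite_length_le Bool B).fintype

theorem log_card_shortString_le (B : ℕ) : Real.log (Fintype.card (ShortString B)) ≤ 2 * B := by
  have h : Fintype.card (ShortString B) ≤ (B + 1) * 2 ^ B := by
    let e : ShortString B → Fin (B + 1) × (Fin B → Bool) := fun s =>
      (⟨s.1.length, Nat.lt_succ_of_le s.2⟩, fun i => s.1.getD i false)
    have he : Function.Injective e := by
      rintro ⟨s, hs⟩ ⟨t, ht⟩ h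
      simp only [e, Prod.mk.injEq, Fin.mk.injEq] at h
      refine Subtype.ext (List.ext_getElem h.1 fun i h1 h2 => ?_)
      have := congrFun h.2 ⟨i, h1.trans_le hs⟩
      simpa [h1, h2] using this
    simpa using Fintype.card_le_of_injective e he
  have h2 : Fintype.card (ShortString B) ≤ 2 ^ (2 * B) := by
    refine h.trans ?_
    rw [two_mul, pow_add]
    exact Nat.mul_le_mul_right _ (Nat.lt_two_pow_self)
  have h0 : 0 < Fintype.card (ShortString B) := Fintype.card_pos_iff.2 ⟨⟨[], by simp⟩⟩
  calc Real.log (Fintype.card (ShortString B)) ≤ Real.log ((2 : ℝ) ^ (2 * B)) :=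
        Real.log_le_log (by exact_mod_cast h0) (by exact_mod_cast h2)
    _ = 2 * B * Real.log 2 := by rw [Real.log_pow]; push_cast; ring
    _ ≤ 2 * B * 1 := by gcongr; linarith [Real.log_two_lt_d9]
    _ = 2 * B := mul_one _

section Rounds

variable {Q Y : Type}

/-- The blackboard after `l` more rounds, with messages truncated to `B` bits. -/
def truncatedRun (B : ℕ) (msg : Q → Y → List (Q → List Bool) → List Bool) (x : Q → Y) :
    ℕ → List (Q → List Bool) → List (Q → List Bool)
  | 0, b => b
  | l + 1, b => truncatedRun B msg x l (b ++ [fun q => (msg q (x q) b).take B])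

/-- Truncation is needed because a finite message alphabet must serve every input and blackboard,
including those that no instance produces. -/
theorem roundComputable_truncatedRun (B : ℕ) (msg : Q → Y → List (Q → List Bool) → List Bool)
    {T : List (Q → List Bool) → ℝ} (hT : ∀ b, |T b| ≤ 1) (l : ℕ) (b : List (Q → List Bool)) :
    RoundComputable (ShortString B) l fun x => T (truncatedRun B msg x l b) := by
  induction l generalizing b with
  | zero => exact ⟨T b, hT b, fun _ => rfl⟩
  | succ l ih =>
    exact ⟨fun q y => ⟨(msg q y b).take B, List.length_take_le _ _⟩,
      fun m x => T (truncatedRun B msg x l (b ++ [fun q => (m q).1])), fun m => ih _, fun _ => rfl⟩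

end Rounds

namespace BlackboardProtocol

variable {r p : ℕ} {X : Type} (π : BlackboardProtocol r p X)

theorem truncatedRun_board {B : ℕ} {x : Fin p → X} {ω : π.Coins} {l s : ℕ}
    (h : ∀ i t, t < s + l → (π.message i (x i) (π.board x ω t) ω.1 (ω.2 i)).length ≤ B) :
    truncatedRun B (fun i y b => π.message i y b ω.1 (ω.2 i)) x l (π.board x ω s) =
      π.board x ω (s + l) := by
  induction l generalizing s with
  | zero => rfl
  | succ l ih =>
    rw [truncatedRun, show s + (l + 1) = s + 1 + l by ring, ← ih fun i t ht => h i t (by omega)]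
    congr 1
    rw [board]
    congr 2
    funext i
    exact List.take_of_length_le (h i s (by omega))

theorem length_message_le_sum (x : Fin p → X) (ω : π.Coins) (i : Fin p) {t l : ℕ} (h : t < l) :
    (π.message i (x i) (π.board x ω t) ω.1 (ω.2 i)).length ≤
      ((π.board x ω l).map fun w => (w i).length).sum := by
  induction l with
  | zero => omega
  | succ l ih =>
    rw [board, List.map_append, List.sum_append]
    rcases Nat.lt_succ_iff_lt_or_eq.1 h with h | rfl
    · exact (ih h).trans (Nat.le_add_right _ _)
    · simp

theorem measurableSet_board_eq (x : Fin p → X) (t : ℕ) (b : Blackboard p) :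
    MeasurableSet {ω : π.Coins | π.board x ω t = b} := by
  induction t generalizing b with
  | zero => exact MeasurableSet.const (([] : Blackboard p) = b)
  | succ t ih =>
    rcases List.eq_nil_or_concat b with rfl | ⟨b, w, rfl⟩
    · convert MeasurableSet.empty
      ext ω
      simp [board]
    · have : {ω : π.Coins | π.board x ω (t + 1) = b ++ [w]} = {ω | π.board x ω t = b} ∩
          ⋂ i, (fun ω : π.Coins => (ω.1, ω.2 i)) ⁻¹'
            {ω | π.message i (x i) b ω.1 ω.2 = w i} := by
        ext ω
        simp only [board, Set.mem_ofPred_eq, Set.mem_inter_iff, Set.mem_iInter, Set.mem_preimage]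
        constructor
        · intro h
          obtain ⟨h1, h2⟩ := List.append_inj' h rfl
          refine ⟨h1, fun i => ?_⟩
          rw [← h1]
          exact congrFun (List.singleton_inj.1 h2) i
        · rintro ⟨h1, h2⟩
          rw [h1]
          congr 2
          funext i
          exact h2 i
      rw [List.concat_eq_append, this]
      refine (ih b).inter (MeasurableSet.iInter fun i => ?_)
      exact (measurable_fst.prodMk ((measurable_pi_apply i).comp measurable_snd))
        (π.measurable_message i (x i) b (w i))

/-- There are only countably many blackboards, and the output is measurable on the event that a
given one occurs. -/
theorem measurable_output (x : Fin p → X) : Measurable (π.output x) := by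
  intro s hs
  have : π.output x ⁻¹' s = ⋃ b : Blackboard p, {ω : π.Coins | π.board x ω r = b} ∩
      (fun ω : π.Coins => π.referee b ω.1) ⁻¹' s := by
    ext ω
    simp [output]
  rw [this]
  exact MeasurableSet.iUnion fun b => (π.measurableSet_board_eq x r b).inter
    (((π.measurable_referee b).comp measurable_fst) hs)

instance : IsProbabilityMeasure π.law := by
  unfold law
  infer_instance

end BlackboardProtocol

/-- If every event is likely, then some outcome belongs to many of the events. -/
theorem exists_le_sum_indicator {ι Ω : Type*} [Fintype ι] [MeasurableSpace Ω] {μ : Measure Ω}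
    [IsProbabilityMeasure μ] {w : ι → ℝ} (hw : ∀ i, 0 ≤ w i) {S : ι → Set Ω}
    (hS : ∀ i, MeasurableSet (S i)) {a : ℝ} (h : ∀ i, a ≤ μ.real (S i)) :
    ∃ ω, a * ∑ i, w i ≤ ∑ i, w i * (S i).indicator 1 ω := by
  have hint : ∀ i ∈ Finset.univ, Integrable (fun ω => w i * (S i).indicator (1 : Ω → ℝ) ω) μ :=
    fun i _ => ((integrable_const (1 : ℝ)).indicator (hS i)).const_mul _
  obtain ⟨ω, hω⟩ := exists_integral_le (integrable_finsetSum _ hint)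
  refine ⟨ω, le_trans ?_ hω⟩
  rw [integral_finsetSum _ hint, Finset.mul_sum]
  refine Finset.sum_le_sum fun i _ => ?_
  rw [integral_const_mul, integral_indicator_one (hS i), mul_comm]
  exact mul_le_mul_of_nonneg_left (h i) (hw i)

/-! ### Approximation yields a distinguisher. -/

namespace CoverDistribution

variable {C : Type} {n m k : ℕ} {c : CoverDistribution C}

/-- The coverage instance given by the inputs of the players. -/
def toInstance (eE : c.Elem ≃ Fin n) (eS : c.Player × c.Index ≃ Fin m) (eP : c.Player ↪ Fin k)
    (y : c.Player → c.Index → Finset c.Elem) : CoverageInstance n m k where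
  sets j := (y (eS.symm j).1 (eS.symm j).2).map eE.toEmbedding
  owner j := eP (eS.symm j).1

variable {eE : c.Elem ≃ Fin n} {eS : c.Player × c.Index ≃ Fin m} {eP : c.Player ↪ Fin k}
  {y : c.Player → c.Index → Finset c.Elem}

theorem opt_toInstance_le {Δ d : ℕ} (h : CoverBound y Δ d) :
    (toInstance eE eS eP y).opt k ≤ Δ + d * k := by
  refine Finset.sup_le fun T hT => ?_
  have h1 : T.biUnion (toInstance eE eS eP y).sets =
      ((T.map eS.symm.toEmbedding).biUnion fun v => y v.1 v.2).map eE.toEmbedding := by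
    ext a
    simp [toInstance]
    aesop
  rw [h1, Finset.card_map]
  refine (h _).trans ?_
  rw [Finset.card_map]
  gcongr
  exact (Finset.mem_filter.1 hT).2

theorem le_opt_toInstance {N : ℕ} (h : CoversAtLeast y N) : N ≤ (toInstance eE eS eP y).opt k := by
  obtain ⟨s, hs⟩ := h
  set T : Finset (Fin m) := Finset.univ.image fun p => eS (p, s p) with hT
  have hTk : T.card ≤ k := by
    refine Finset.card_image_le.trans ?_
    simpa using Fintype.card_le_of_embedding eP
  have h1 : T.biUnion (toInstance eE eS eP y).sets =
      (Finset.univ.biUnion fun p => y p (s p)).map eE.toEmbedding := by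
    ext a
    simp [toInstance, hT]
  refine hs.trans ?_
  rw [← Finset.card_map eE.toEmbedding, ← h1]
  exact Finset.le_sup (f := fun T : Finset (Fin m) => (T.biUnion (toInstance eE eS eP y).sets).card)
    (Finset.mem_filter.2 ⟨Finset.mem_univ _, hTk⟩)

theorem roundComputable_toInstance [DecidableEq C] {Ξ : Type} {l : ℕ}
    {F : (Fin k → Fin m → Option (Finset (Fin n))) → ℝ} (hF : RoundComputable Ξ l F) :
    RoundComputable Ξ l fun y => F (toInstance eE eS eP y).view := by
  refine hF.comp_embedding eP.injective
    (h := fun p x j => if (eS.symm j).1 = p then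
      some ((x (eS.symm j).2).map eE.toEmbedding) else none)
    (y := fun _ _ => none) (fun y p => ?_) fun y q hq => ?_
  · funext j
    simp only [CoverageInstance.view, toInstance, EmbeddingLike.apply_eq_iff_eq]
    split_ifs with h
    · rw [h]
    · rfl
  · funext j
    simp only [CoverageInstance.view, toInstance]
    exact if_neg fun h => hq ⟨_, h⟩

/-- A protocol that approximates the optimum has a large advantage. -/
theorem half_le_of_approximates {r : ℕ} {α : ℝ} (hα : 1 ≤ α) {π : CoverageProtocol r n m k}
    (hπ : π.Approximates k α) {B : ℕ} (hB : π.CommunicationAtMost B)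
    (hn : Fintype.card c.Elem = n) (hm : Fintype.card c.Player * Fintype.card c.Index = m)
    (hk : Fintype.card c.Player ≤ k) {N Δ d : ℕ}
    (hyes : ∀ y, c.law true y ≠ 0 → CoversAtLeast y N)
    (hno : ∀ y, c.law false y ≠ 0 → CoverBound y Δ d)
    (hgap : α * (Δ + d * k : ℕ) < N) {ε : ℝ}
    (hadv : AdvantageAtMost (ShortString B) c.law r ε) : 1 / 2 ≤ ε := by
  classical
  have eE : c.Elem ≃ Fin n := Fintype.equivFinOfCardEq hn
  have eS : c.Player × c.Index ≃ Fin m :=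
    Fintype.equivFinOfCardEq (by rw [Fintype.card_prod, hm])
  -- Machines outside the range of this embedding hold no sets.
  obtain ⟨eP⟩ : Nonempty (c.Player ↪ Fin k) :=
    Function.Embedding.nonempty_of_card_le (by simpa using hk)
  set inst := toInstance eE eS eP with hinst
  set S : Bool × (c.Player → c.Index → Finset c.Elem) → Set π.Coins := fun v =>
    {ω | π.output (inst v.2).view ω ≤ ((inst v.2).opt k : ℝ) ∧
      ((inst v.2).opt k : ℝ) ≤ α * π.output (inst v.2).view ω} with hSdef
  have hSm : ∀ v, MeasurableSet (S v) := fun v =>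
    (measurableSet_le (π.measurable_output _) measurable_const).inter
      (measurableSet_le measurable_const ((π.measurable_output _).const_mul α))
  have hSp : ∀ v, (3 / 4 : ℝ) ≤ π.law.real (S v) := by
    intro v
    have := ENNReal.toReal_mono (measure_ne_top _ _) (hπ (inst v.2))
    simpa [Measure.real, hSdef] using this
  -- One outcome of all the coins serves both laws at once: its success weights sum to at least 2 ·
  -- 3/4 = 3/2.
  obtain ⟨ω, hω⟩ := exists_le_sum_indicator (fun v => (c.isProbWeight_law v.1).nonneg v.2) hSm hSp
  simp only [Fintype.sum_prod_type, Fintype.sum_bool, (c.isProbWeight_law _).sum_eq_one] at hω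
  -- The test compares the output with the largest possible "no" optimum. By `hgap` every success on
  -- "yes" exceeds it, so the advantage is at least 3/2 - 1.
  set T : Blackboard k → ℝ := fun b => if ((Δ + d * k : ℕ) : ℝ) < π.referee b ω.1 then 1 else 0
    with hT
  have hT1 : ∀ b, |T b| ≤ 1 := fun b => by simp only [hT]; split_ifs <;> simp
  have hF := hadv _ (roundComputable_toInstance (eE := eE) (eS := eS) (eP := eP)
    (roundComputable_truncatedRun B (fun i y b => π.message i y b ω.1 (ω.2 i)) hT1 r []))
  have hrun : ∀ y, truncatedRun B (fun i y b => π.message i y b ω.1 (ω.2 i)) (inst y).view r [] =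
      π.board (inst y).view ω r := by
    intro y
    have := π.truncatedRun_board (B := B) (x := (inst y).view) (ω := ω) (l := r) (s := 0)
      fun i t ht => (π.length_message_le_sum _ ω i (by simpa using ht)).trans (hB (inst y) ω i)
    rwa [Nat.zero_add] at this
  simp only [← hinst, hrun] at hF
  have h1 : ∑ y, c.law true y * (S (true, y)).indicator 1 ω ≤
      ∑ y, c.law true y * T (π.board (inst y).view ω r) := by
    refine Finset.sum_le_sum fun y _ => ?_
    by_cases hy : c.law true y = 0
    · simp [hy]
    refine mul_le_mul_of_nonneg_left ?_ ((c.isProbWeight_law true).nonneg y)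
    by_cases hs : ω ∈ S (true, y)
    · rw [Set.indicator_of_mem hs]
      have hN : (N : ℝ) ≤ (inst y).opt k := by exact_mod_cast le_opt_toInstance (hyes y hy)
      have h3 : α * (Δ + d * k : ℕ) < α * π.referee (π.board (inst y).view ω r) ω.1 :=
        hgap.trans_le (hN.trans hs.2)
      have h4 := lt_of_mul_lt_mul_left h3 (by linarith)
      simp only [hT, if_pos h4]
      exact le_rfl
    · rw [Set.indicator_of_notMem hs]
      simp only [hT]
      split_ifs <;> simp
  have h0 : ∑ y, c.law false y * T (π.board (inst y).view ω r) ≤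
      1 - ∑ y, c.law false y * (S (false, y)).indicator 1 ω := by
    rw [← (c.isProbWeight_law false).sum_eq_one, ← Finset.sum_sub_distrib]
    refine Finset.sum_le_sum fun y _ => ?_
    by_cases hy : c.law false y = 0
    · simp [hy]
    rw [← mul_one_sub]
    refine mul_le_mul_of_nonneg_left ?_ ((c.isProbWeight_law false).nonneg y)
    by_cases hs : ω ∈ S (false, y)
    · rw [Set.indicator_of_mem hs]
      have hN : ((inst y).opt k : ℝ) ≤ (Δ + d * k : ℕ) := by
        exact_mod_cast opt_toInstance_le (hno y hy)
      have h4 : ¬((Δ + d * k : ℕ) : ℝ) < π.referee (π.board (inst y).view ω r) ω.1 :=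
        not_lt.2 (hs.1.trans hN)
      simp only [hT, if_neg h4]
      simp
    · rw [Set.indicator_of_notMem hs]
      simp only [hT]
      split_ifs <;> simp
  have := (abs_le.1 hF).2
  linarith

end CoverDistribution

/-! ### Polynomials, parameters and the final estimate. -/

/-- Distinct polynomials of degree less than `d` agree in at most `d` points. -/
theorem card_agreement_le {K : Type*} [Field K] [Fintype K] [DecidableEq K] {d : ℕ}
    {a b : Fin d → K} (hab : a ≠ b) :
    (Finset.univ.filter fun x => ∑ i, a i * x ^ (i : ℕ) = ∑ i, b i * x ^ (i : ℕ)).card ≤ d := by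
  classical
  set p : Polynomial K := ∑ i : Fin d, Polynomial.C (a i - b i) * Polynomial.X ^ (i : ℕ) with hp
  have hp0 : p ≠ 0 := by
    obtain ⟨i, hi⟩ := Function.ne_iff.1 hab
    intro h
    have h1 : p.coeff i = a i - b i := by
      simp only [hp, Polynomial.finsetSum_coeff, Polynomial.coeff_C_mul, Polynomial.coeff_X_pow,
        Fin.val_inj]
      simp
    rw [h, Polynomial.coeff_zero] at h1
    exact hi (sub_eq_zero.1 h1.symm)
  have hdeg : p.natDegree ≤ d := Polynomial.natDegree_sum_le_of_forall_le _ _ fun i _ =>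
    (Polynomial.natDegree_C_mul_X_pow_le _ _).trans i.2.le
  refine le_trans ?_ ((Multiset.toFinset_card_le _).trans ((Polynomial.card_roots' p).trans hdeg))
  refine Finset.card_le_card fun x hx => ?_
  rw [Multiset.mem_toFinset, Polynomial.mem_roots hp0, Polynomial.IsRoot.def]
  simp only [hp, Polynomial.eval_finsetSum, Polynomial.eval_mul, Polynomial.eval_C,
    Polynomial.eval_pow, Polynomial.eval_X, sub_mul, Finset.sum_sub_distrib]
  exact sub_eq_zero.2 (Finset.mem_filter.1 hx).2

/-- The range of the parameters. -/
theorem log_bounds {r c k : ℕ} (hr : 1 ≤ r) (hc : 4 * r ≤ c) (hk : 3 ≤ k)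
    (h : (c : ℝ) ≤ 1 / 200 * (Real.log k / Real.log (Real.log k))) :
    64 ≤ Real.log k ∧ (c : ℝ) ≤ Real.log k ∧ Real.log k ≤ (k : ℝ) ^ (1 / (2 * (r : ℝ))) := by
  set L := Real.log k with hL
  have hk0 : (0 : ℝ) < k := by positivity
  have hr' : (1 : ℝ) ≤ r := by exact_mod_cast hr
  have hc' : 4 * (r : ℝ) ≤ c := by exact_mod_cast hc
  -- From e^1.09 < 3 ≤ k. This makes log log k at least 0.08, in particular positive, so the
  -- hypothesis can be multiplied out.
  have hL1 : 1.09 ≤ L := by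
    rw [hL, Real.le_log_iff_exp_le hk0]
    have h1 : Real.exp 0.09 ≤ 1.1 := by
      have h2 := Real.add_one_le_exp (-0.09 : ℝ)
      have h3 : Real.exp 0.09 * Real.exp (-0.09) = 1 := by rw [← Real.exp_add]; norm_num
      nlinarith [Real.exp_pos (0.09 : ℝ)]
    have h4 : Real.exp 1.09 = Real.exp 1 * Real.exp 0.09 := by rw [← Real.exp_add]; norm_num
    have h5 : (3 : ℝ) ≤ k := by exact_mod_cast hk
    rw [h4]
    nlinarith [Real.exp_one_lt_d9, Real.exp_pos (1 : ℝ), Real.exp_pos (0.09 : ℝ)]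
  have hlog : 1 - L⁻¹ ≤ Real.log L := Real.one_sub_inv_le_log_of_pos (by linarith)
  have hinv : L⁻¹ ≤ 1 / 1.09 := by
    rw [← one_div]; exact one_div_le_one_div_of_le (by norm_num) hL1
  have hpos : 0.08 ≤ Real.log L := by norm_num at hinv ⊢; linarith
  have hmul : (c : ℝ) * Real.log L ≤ 1 / 200 * L := by
    rw [← mul_div_assoc, le_div_iff₀ (by linarith)] at h
    exact h
  -- Since c ≥ 4 and log L ≥ 0.08, L ≥ 200 · 4 · 0.08 = 64.
  have h64 : 64 ≤ L := by nlinarith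
  have hlog1 : 1 / 2 ≤ Real.log L := by
    have : L⁻¹ ≤ 1 / 64 := by
      rw [← one_div]; exact one_div_le_one_div_of_le (by norm_num) h64
    linarith
  refine ⟨h64, by nlinarith, ?_⟩
  rw [← Real.log_le_log_iff (by linarith) (Real.rpow_pos_of_pos hk0 _), Real.log_rpow hk0, ← hL,
    div_mul_eq_mul_div, one_mul, le_div_iff₀ (by linarith)]
  nlinarith

/-- The real estimates on the number `g` of groups and the number `q` of colours. -/
theorem exists_parameters {r c k : ℕ} (hr : 1 ≤ r) (hc : 4 * r ≤ c) (hk : 3 ≤ k)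
    (h : (c : ℝ) ≤ 1 / 200 * (Real.log k / Real.log (Real.log k))) :
    ∃ q g : ℕ, q.Prime ∧ g ^ r ≤ k ∧ q ^ (2 * r) ≤ k ∧ k ≤ q ^ (4 * r) ∧
      (k : ℝ) ^ (1 / (2 * (r : ℝ))) * k / 4 ≤ q * (g : ℝ) ^ r ∧
      (q : ℝ) * ((q - 1 + g : ℕ) : ℝ) ^ r ≤ (k : ℝ) ^ (1 / (2 * (r : ℝ))) * (3 * k) ∧
      r * (q * (q - 1) * (q - 1 + g) ^ (r - 1)) ≤ c * k ∧ k ≤ q * g ^ r ∧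
      q * (q - 1 + g) ^ r ≤ k ^ 3 := by
  obtain ⟨h64, hcL, hLκ⟩ := log_bounds hr hc hk h
  set κ : ℝ := (k : ℝ) ^ (1 / (2 * (r : ℝ))) with hκ
  have hk3 : (3 : ℝ) ≤ k := by exact_mod_cast hk
  have hr' : (1 : ℝ) ≤ r := by exact_mod_cast hr
  have hc' : 4 * (r : ℝ) ≤ c := by exact_mod_cast hc
  have hrκ : 4 * (r : ℝ) ≤ κ := by linarith
  have hκ64 : 64 ≤ κ := by linarith
  have hκk : κ ^ (2 * r) = k := by
    rw [hκ, ← Real.rpow_natCast, ← Real.rpow_mul (by linarith)]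
    have : 1 / (2 * (r : ℝ)) * ((2 * r : ℕ) : ℝ) = 1 := by
      push_cast; field_simp
    rw [this, Real.rpow_one]
  have hκk2 : (κ ^ 2) ^ r = k := by rw [← pow_mul, hκk]
  have hκle : κ ≤ k := by
    rw [← hκk]
    exact le_self_pow₀ (by linarith) (by omega)
  have hfl : ⌊κ / 2⌋₊ ≠ 0 := by
    have : 0 < ⌊κ / 2⌋₊ := Nat.floor_pos.2 (by linarith)
    omega
  -- Bertrand's postulate gives a prime between κ/2 and κ.
  obtain ⟨q, hq, hq1, hq2⟩ := Nat.exists_prime_lt_and_le_two_mul _ hfl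
  have hqlo : κ / 2 ≤ q := by
    have h1 := Nat.lt_floor_add_one (κ / 2)
    have h2 : ((⌊κ / 2⌋₊ : ℕ) : ℝ) + 1 ≤ q := by exact_mod_cast hq1
    linarith
  have hqhi : (q : ℝ) ≤ κ := by
    have h1 := Nat.floor_le (show 0 ≤ κ / 2 by linarith)
    have h2 : (q : ℝ) ≤ 2 * (⌊κ / 2⌋₊ : ℕ) := by exact_mod_cast hq2
    linarith
  set g := ⌊κ ^ 2⌋₊ with hg
  have hghi : (g : ℝ) ≤ κ ^ 2 := Nat.floor_le (by positivity)
  have hglo : κ ^ 2 - 1 ≤ g := by linarith [Nat.lt_floor_add_one (κ ^ 2)]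
  have hqg : q ^ 2 ≤ g := by
    rw [hg]
    refine Nat.le_floor ?_
    push_cast
    gcongr
  have hgr : (g : ℝ) ^ r ≤ k := by rw [← hκk2]; gcongr
  -- Rounding κ² down loses at most a factor 2 in the `r`-th power, by Bernoulli's inequality and
  -- r/κ² ≤ 1/2.
  have hgr2 : (k : ℝ) / 2 ≤ (g : ℝ) ^ r := by
    have h1 : (κ ^ 2 - 1) ^ r ≤ (g : ℝ) ^ r := pow_le_pow_left₀ (by nlinarith) hglo _
    have h2 : κ ^ 2 - 1 = κ ^ 2 * (1 + -(1 / κ ^ 2)) := by field_simp; ring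
    have h3 : (1 : ℝ) / κ ^ 2 ≤ 1 := by rw [div_le_one (by positivity)]; nlinarith
    have h4 := one_add_mul_le_pow (show (-2 : ℝ) ≤ -(1 / κ ^ 2) by linarith) r
    have h5 : (r : ℝ) * (1 / κ ^ 2) ≤ 1 / 2 := by
      rw [mul_one_div, div_le_iff₀ (by positivity)]; nlinarith
    rw [h2, mul_pow, hκk2] at h1
    nlinarith
  have hsum : ((q - 1 + g : ℕ) : ℝ) ≤ κ ^ 2 + κ := by
    have : ((q - 1 : ℕ) : ℝ) ≤ q := by exact_mod_cast Nat.sub_le _ _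
    push_cast
    linarith
  -- The additional q costs a factor (1 + 1/κ)^r ≤ e < 3, since r ≤ κ.
  have hsumr : ((q - 1 + g : ℕ) : ℝ) ^ r ≤ 3 * k := by
    have h1 : ((q - 1 + g : ℕ) : ℝ) ^ r ≤ (κ ^ 2 + κ) ^ r := pow_le_pow_left₀ (by positivity) hsum _
    have h2 : κ ^ 2 + κ = κ ^ 2 * (1 + 1 / κ) := by field_simp
    have h3 : (1 + 1 / κ) ^ r ≤ Real.exp 1 := by
      calc (1 + 1 / κ) ^ r ≤ Real.exp (1 / κ) ^ r := by
            gcongr; linarith [Real.add_one_le_exp (1 / κ)]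
        _ = Real.exp (r * (1 / κ)) := (Real.exp_nat_mul _ _).symm
        _ ≤ Real.exp 1 := by
            gcongr
            rw [mul_one_div, div_le_one (by linarith)]; linarith
    rw [h2, mul_pow, hκk2] at h1
    nlinarith [Real.exp_one_lt_d9]
  have hsumrN : (q - 1 + g) ^ r ≤ 3 * k := by exact_mod_cast hsumr
  refine ⟨q, g, hq, by exact_mod_cast hgr, ?_, ?_, ?_, ?_, ?_, ?_, ?_⟩
  · have : (q : ℝ) ^ (2 * r) ≤ k := by rw [← hκk]; gcongr
    exact_mod_cast this
  · have : (k : ℝ) ≤ (q : ℝ) ^ (4 * r) := by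
      rw [← hκk, show 4 * r = 2 * (2 * r) by ring, pow_mul (q : ℝ)]
      gcongr
      nlinarith
    exact_mod_cast this
  · calc κ * k / 4 = κ / 2 * (k / 2) := by ring
      _ ≤ _ := mul_le_mul hqlo hgr2 (by linarith) (by linarith)
  · exact mul_le_mul hqhi hsumr (pow_nonneg (Nat.cast_nonneg _) _) (by linarith)
  -- The choice q² ≤ g is made for this: it lets q(q-1) be absorbed by one more factor q-1+g.
  · calc r * (q * (q - 1) * (q - 1 + g) ^ (r - 1)) ≤ r * (q ^ 2 * (q - 1 + g) ^ (r - 1)) := by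
          rw [sq]; gcongr; exact Nat.sub_le _ _
      _ ≤ r * ((q - 1 + g) * (q - 1 + g) ^ (r - 1)) := by gcongr; omega
      _ = r * (q - 1 + g) ^ r := by rw [← pow_succ', Nat.sub_add_cancel hr]
      _ ≤ r * (3 * k) := by gcongr
      _ = 3 * r * k := by ring
      _ ≤ c * k := by gcongr; omega
  · have : (k : ℝ) ≤ q * (g : ℝ) ^ r := by
      calc (k : ℝ) = 2 * (k / 2) := by ring
        _ ≤ _ := mul_le_mul (by linarith) hgr2 (by linarith) (by linarith)
    exact_mod_cast this
  · have : (q : ℝ) ≤ k := hqhi.trans hκle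
    have h1 : q ≤ k := by exact_mod_cast this
    calc q * (q - 1 + g) ^ r ≤ k * (3 * k) := by gcongr
      _ ≤ k * (k * k) := by gcongr
      _ = k ^ 3 := by ring

/-- Here t = 1/(100k²): as r and G are at most k, the quadratic error costs at most 2k² · 4t = 2/25.
The message term is negligible because w exceeds B by a factor k^10. -/
theorem advantage_lt_half {k r G B w : ℝ} (hk : 64 ≤ k) (hr : r ≤ k) (hG0 : 0 ≤ G)
    (hG : G ≤ k) (hB0 : 0 ≤ B) (hw : 0 < w) (hB : B * k ^ 10 ≤ w) :
    2 * r * G * (2 * B / (1 / (100 * k ^ 2) * w) + 4 * (1 / (100 * k ^ 2))) < 1 / 2 := by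
  have hk0 : 0 < k := by linarith
  have h1 : 2 * B / (1 / (100 * k ^ 2) * w) ≤ 200 / k ^ 8 := by
    have e : 2 * B / (1 / (100 * k ^ 2) * w) = 200 * (B * k ^ 10) / (w * k ^ 8) := by
      field_simp; ring
    rw [e, div_le_div_iff₀ (by positivity) (by positivity)]
    calc 200 * (B * k ^ 10) * k ^ 8 ≤ 200 * w * k ^ 8 := by gcongr
      _ = 200 * (w * k ^ 8) := by ring
  have h2 : 2 * r * G ≤ 2 * k ^ 2 := by
    calc 2 * r * G ≤ 2 * k * k := by gcongr
      _ = 2 * k ^ 2 := by ring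
  calc 2 * r * G * (2 * B / (1 / (100 * k ^ 2) * w) + 4 * (1 / (100 * k ^ 2)))
      ≤ 2 * k ^ 2 * (200 / k ^ 8 + 4 * (1 / (100 * k ^ 2))) := by gcongr
    _ = 400 / k ^ 6 + 2 / 25 := by field_simp; ring
    _ ≤ 400 / 64 ^ 6 + 2 / 25 := by gcongr
    _ < 1 / 2 := by norm_num

theorem mainTheorem1 :
    ∃ ε δ a₁ a₂ b₁ b₂ : ℝ, 0 < ε ∧ 0 < δ ∧ 0 < a₁ ∧ 0 < a₂ ∧ 0 < b₁ ∧ 0 < b₂ ∧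
      ∀ r c k : ℕ, 1 ≤ r → 4 * r ≤ c → 3 ≤ k →
        (c : ℝ) ≤ ε * (Real.log k / Real.log (Real.log k)) →
        ∃ n m : ℕ,
          ((m : ℝ) ^ (1 / (a₂ * (c : ℝ))) ≤ n ∧ (n : ℝ) ≤ (m : ℝ) ^ (1 / (a₁ * (c : ℝ)))) ∧
          (b₁ * (n : ℝ) ^ (2 * (r : ℝ) / (2 * r + 1)) ≤ k ∧
            (k : ℝ) ≤ b₂ * (n : ℝ) ^ (2 * (r : ℝ) / (2 * r + 1))) ∧
          ∀ α : ℝ, 1 ≤ α → α < 1 / (2 * (c : ℝ)) * ((k : ℝ) ^ (1 / (2 * (r : ℝ))) / Real.log k) →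
            ∀ π : CoverageProtocol r n m k, π.Approximates k α →
              ∀ B : ℕ, π.CommunicationAtMost B →
                δ * ((k : ℝ) / (r : ℝ) ^ 4 *
                  (m : ℝ) ^ ((c : ℝ) / (((c : ℝ) + 2) * (4 * r)))) ≤ B := by
  refine ⟨1 / 200, 1, 1, 9, 1 / 3, 4, by norm_num, by norm_num, by norm_num, by norm_num,
    by norm_num, by norm_num, fun r c k hr hc hk hck => ?_⟩
  obtain ⟨h64, -, -⟩ := log_bounds hr hc hk hck
  obtain ⟨q, g, hq, hgk, hqk, hkq, hlo, hhi, hΔ, hkn, hnk⟩ := exists_parameters hr hc hk hck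
  set κ : ℝ := (k : ℝ) ^ (1 / (2 * (r : ℝ))) with hκ
  have hk3 : (3 : ℝ) ≤ k := by exact_mod_cast hk
  have hr' : (1 : ℝ) ≤ r := by exact_mod_cast hr
  have hc' : 4 * (r : ℝ) ≤ c := by exact_mod_cast hc
  have hκ0 : 0 < κ := Real.rpow_pos_of_pos (by linarith) _
  have hq0 : 0 < q := hq.pos
  have hkpos : 0 < k := by omega
  set n := q * (q - 1 + g) ^ r with hn
  -- The number of players times the number of sets of each player in `hard`, when `J` is the set of
  -- polynomials with 16c coefficients.
  set m := g ^ r * (q ^ (16 * c)) ^ r with hm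
  have hkn' : k ≤ n := hkn.trans (by rw [hn]; gcongr; omega)
  have hg0 : 0 < g ^ r := Nat.pos_of_mul_pos_left (hkpos.trans_le hkn)
  have hm0 : 0 < m := by positivity
  have hmhi : m ≤ n ^ (9 * c) := by
    calc m = g ^ r * (q ^ (2 * r)) ^ (8 * c) := by rw [hm]; ring
      _ ≤ k * k ^ (8 * c) := by gcongr
      _ ≤ k ^ c * k ^ (8 * c) := by gcongr; exact Nat.le_self_pow (by omega) k
      _ = k ^ (9 * c) := by ring
      _ ≤ n ^ (9 * c) := by gcongr
  have hmlo : n ^ c ≤ m := by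
    calc n ^ c ≤ (k ^ 3) ^ c := by gcongr
      _ ≤ (k ^ 4) ^ c := by gcongr; omega
      _ ≤ ((q ^ (4 * r)) ^ 4) ^ c := by gcongr
      _ = 1 * (q ^ (16 * c)) ^ r := by ring
      _ ≤ m := by rw [hm]; gcongr; exact hg0
  have hκk : κ * k = (k : ℝ) ^ ((2 * (r : ℝ) + 1) / (2 * r)) := by
    rw [hκ]
    nth_rewrite 2 [← Real.rpow_one (k : ℝ)]
    rw [← Real.rpow_add (by linarith)]
    congr 1
    field_simp
    ring
  have hs : (κ * k) ^ (2 * (r : ℝ) / (2 * r + 1)) = k := by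
    rw [hκk, ← Real.rpow_mul (by linarith)]
    have : (2 * (r : ℝ) + 1) / (2 * r) * (2 * r / (2 * r + 1)) = 1 := by field_simp
    rw [this, Real.rpow_one]
  have hs0 : 0 ≤ 2 * (r : ℝ) / (2 * r + 1) := by positivity
  have hs1 : 2 * (r : ℝ) / (2 * r + 1) ≤ 1 := by
    rw [div_le_one (by linarith)]; linarith
  have hnhi : (n : ℝ) ≤ 3 * (κ * k) := by rw [hn]; push_cast at hhi ⊢; linarith
  have hnlo : 1 / 4 * (κ * k) ≤ n := by
    have : (q : ℝ) * (g : ℝ) ^ r ≤ n := by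
      rw [hn]; exact_mod_cast Nat.mul_le_mul_left _ (Nat.pow_le_pow_left (by omega) r)
    linarith
  refine ⟨n, m, ⟨?_, ?_⟩, ⟨?_, ?_⟩, fun α hα1 hα π hπ B hB => ?_⟩
  · rw [one_div, Real.rpow_inv_le_iff_of_pos (by positivity) (by positivity) (by linarith)]
    have : (9 : ℝ) * c = ((9 * c : ℕ) : ℝ) := by push_cast; ring
    rw [this, Real.rpow_natCast]
    exact_mod_cast hmhi
  · rw [one_div, Real.le_rpow_inv_iff_of_pos (by positivity) (by positivity) (by linarith), one_mul,
      Real.rpow_natCast]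
    exact_mod_cast hmlo
  · have h1 : (n : ℝ) ^ (2 * (r : ℝ) / (2 * r + 1)) ≤ 3 * k := by
      refine (Real.rpow_le_rpow (by positivity) hnhi hs0).trans ?_
      rw [Real.mul_rpow (by norm_num) (by positivity), hs]
      gcongr
      exact (Real.rpow_le_rpow_of_exponent_le (by norm_num) hs1).trans_eq (Real.rpow_one _)
    linarith
  · have h1 : 1 / 4 * (k : ℝ) ≤ (n : ℝ) ^ (2 * (r : ℝ) / (2 * r + 1)) := by
      refine le_trans ?_ (Real.rpow_le_rpow (by positivity) hnlo hs0)
      rw [Real.mul_rpow (by norm_num) (by positivity), hs]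
      gcongr
      exact (Real.rpow_one _).symm.trans_le
        (Real.rpow_le_rpow_of_exponent_ge (by norm_num) (by norm_num) hs1)
    linarith
  · by_contra hlt
    rw [not_le, one_mul] at hlt
    -- The claimed bound is relaxed: 1/r⁴ ≤ 1 and the exponent of m is at most 1/(4r), while
    -- m^(1/(4r)) ≤ k q^(4c).
    have hBlt : (B : ℝ) < k * (k * q ^ (4 * c)) := by
      refine hlt.trans_le ?_
      have h1 : (m : ℝ) ^ ((c : ℝ) / (((c : ℝ) + 2) * (4 * r))) ≤ k * q ^ (4 * c) := by
        have h2 : (c : ℝ) / (((c : ℝ) + 2) * (4 * r)) ≤ (4 * (r : ℝ))⁻¹ := by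
          rw [div_le_iff₀ (by positivity), mul_comm ((c : ℝ) + 2), ← mul_assoc,
            inv_mul_cancel₀ (by positivity)]
          linarith
        refine (Real.rpow_le_rpow_of_exponent_le (by exact_mod_cast hm0) h2).trans ?_
        rw [Real.rpow_inv_le_iff_of_pos (by positivity) (by positivity) (by linarith)]
        have : (4 : ℝ) * r = ((4 * r : ℕ) : ℝ) := by push_cast; ring
        rw [this, Real.rpow_natCast]
        have h3 : m ≤ (k * q ^ (4 * c)) ^ (4 * r) := by
          calc m ≤ k * (q ^ (16 * c)) ^ r := by rw [hm]; gcongr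
            _ ≤ k ^ (4 * r) * (q ^ (16 * c)) ^ r := by
                gcongr; exact Nat.le_self_pow (by omega) k
            _ = _ := by ring
        exact_mod_cast h3
      have h4 : (k : ℝ) / (r : ℝ) ^ 4 ≤ k := div_le_self (by linarith) (one_le_pow₀ hr')
      gcongr
    have : Fact q.Prime := ⟨hq⟩
    have : NeZero g := ⟨fun h => by simp [h, show r ≠ 0 by omega] at hg0⟩
    let f : (Fin (16 * c) → ZMod q) → ZMod q → ZMod q := fun a x => ∑ i, a i * x ^ (i : ℕ)
    have hC : Fintype.card (ZMod q) = q := ZMod.card q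
    have hJ : Fintype.card (Fin (16 * c) → ZMod q) = q ^ (16 * c) := by simp
    have hno := CoverDistribution.coverBound_hard (G := Fin g) f r (d := 16 * c)
      fun _ _ => card_agreement_le
    have hyes := CoverDistribution.coversAtLeast_hard (G := Fin g) f r
    rw [hC, Fintype.card_fin] at hno hyes
    have hadv := CoverDistribution.advantageAtMost_hard (G := Fin g) f r (Ξ := ShortString B)
      (t := 1 / (100 * (k : ℝ) ^ 2)) (by positivity)
      (by rw [div_le_div_iff₀ (by positivity) (by norm_num)]; nlinarith) (log_card_shortString_le B)
    -- The "no" optimum is at most ck + 16ck = 17ck, and log k ≥ 64 makes 17/(2 log k) at most 1/4,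
    -- the constant in q g^r ≥ κk/4.
    have hgap : α * ((r * (q * (q - 1) * (q - 1 + g) ^ (r - 1)) + 16 * c * k : ℕ) : ℝ) <
        ((q * g ^ r : ℕ) : ℝ) := by
      have h1 : ((r * (q * (q - 1) * (q - 1 + g) ^ (r - 1)) + 16 * c * k : ℕ) : ℝ) ≤ 17 * (c * k) := by
        have : r * (q * (q - 1) * (q - 1 + g) ^ (r - 1)) + 16 * c * k ≤ 17 * (c * k) := by
          linarith
        exact_mod_cast this
      calc _ ≤ α * (17 * (c * k)) := by gcongr
        _ < 1 / (2 * (c : ℝ)) * (κ / Real.log k) * (17 * (c * k)) := by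
            gcongr
            exact mul_pos (by norm_num) (mul_pos (by linarith) (by linarith))
        _ = κ * k * (17 / (2 * Real.log k)) := by
            have : (c : ℝ) ≠ 0 := by linarith
            field_simp
        _ ≤ κ * k * (1 / 4) := by
            refine mul_le_mul_of_nonneg_left ?_ (by positivity)
            rw [div_le_div_iff₀ (by linarith) (by norm_num)]
            linarith
        _ ≤ _ := by push_cast; linarith
    have hhalf := CoverDistribution.half_le_of_approximates hα1 hπ hB
      (by rw [CoverDistribution.card_elem_hard, hC, Fintype.card_fin])
      (by rw [CoverDistribution.card_player_hard, CoverDistribution.card_index_hard, hJ,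
        Fintype.card_fin])
      (by rw [CoverDistribution.card_player_hard, Fintype.card_fin]; exact hgk)
      hyes hno hgap hadv
    rw [hJ, Fintype.card_fin] at hhalf
    have hk64 : (64 : ℝ) ≤ k := by linarith [Real.log_le_self (show (0 : ℝ) ≤ k by linarith)]
    have hrk : (r : ℝ) ≤ k := by
      have : r ≤ k := ((Nat.lt_pow_self hq.one_lt).le.trans
        (Nat.pow_le_pow_right hq0 (show r ≤ 2 * r by omega))).trans hqk
      exact_mod_cast this
    have hgk' : (g : ℝ) ^ r ≤ k := by exact_mod_cast hgk
    -- The exponent 16c leaves room for k^12 ≤ q^(48r) ≤ q^(12c), where 4r ≤ c is used.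
    have hw : (k : ℝ) ^ 12 * q ^ (4 * c) ≤ ((q ^ (16 * c) : ℕ) : ℝ) := by
      have : k ^ 12 * q ^ (4 * c) ≤ q ^ (16 * c) := by
        calc k ^ 12 * q ^ (4 * c) ≤ (q ^ (4 * r)) ^ 12 * q ^ (4 * c) := by gcongr
          _ = q ^ (48 * r) * q ^ (4 * c) := by ring
          _ ≤ q ^ (12 * c) * q ^ (4 * c) := by
              gcongr ?_ * _; exact Nat.pow_le_pow_right hq0 (by omega)
          _ = q ^ (16 * c) := by ring
      exact_mod_cast this
    set w : ℝ := ((q ^ (16 * c) : ℕ) : ℝ) with hwdef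
    have hw0 : 0 < w := by positivity
    have hBw : (B : ℝ) * k ^ 10 ≤ w := by
      refine le_trans ?_ hw
      calc (B : ℝ) * k ^ 10 ≤ k * (k * q ^ (4 * c)) * k ^ 10 := by gcongr
        _ = _ := by ring
    exact absurd hhalf (not_le.2 (advantage_lt_half hk64 hrk (by positivity) hgk'
      (by positivity) hw0 hBw))
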